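/- Let $S$ be a finite set of points in the plane in general position (no three on a line). A pseudo-triangle is a simple polygon with exactly three vertices at which the interior angle is less than $180^\circ$; an $\ell$-pseudo-triangle is one with $\ell$ vertices. We say that $S$ contains an $\ell$-pseudo-triangle if some $\ell$ points of $S$ are the vertices of one, and that $S$ contains an empty $\ell$-pseudo-triangle if some $\ell$ points of $S$ are the vertices of one that has no point of $S$ in its interior. (i) If the convex hull of $S$ has exactly three vertices and at least $5$ points of $S$ lie in its interior, then $S$ contains an empty $7$-pseudo-triangle. (ii) There is a finite set of points in the plane in general position whose convex hull has exactly three vertices, with exactly $4$ points of the set in its interior, that contains no $7$-pseudo-triangle (empty or not). -/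

import Mathlib

noncomputable section

/-- The Euclidean plane. -/
abbrev Plane : Type := EuclideanSpace ℝ (Fin 2)

/-- No three distinct points of `S` lie on a line. -/
def InGeneralPosition (S : Set Plane) : Prop :=
  ∀ a ∈ S, ∀ b ∈ S, ∀ c ∈ S, a ≠ b → a ≠ c → b ≠ c → ¬ Collinear ℝ {a, b, c}

/-- The vertices of the convex hull of `S`. -/
def hullVertices (S : Set Plane) : Set Plane :=
  (convexHull ℝ S).extremePoints ℝ

/-- The points of `S` in the interior of the convex hull of `S`. -/
def hullInteriorPoints (S : Set Plane) : Set Plane :=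
  S ∩ interior (convexHull ℝ S)

/-- The cross product of `u` and `v`; it is positive iff `v` points strictly to the left of `u`. -/
def cross (u v : Plane) : ℝ :=
  u 0 * v 1 - u 1 * v 0

/-- The vertex after the `i`-th one, cyclically. -/
def Polygon.next {n : ℕ} (P : Polygon Plane n) (i : Fin n) : Plane :=
  P (finRotate n i)

/-- The vertex before the `i`-th one, cyclically. -/
def Polygon.prev {n : ℕ} (P : Polygon Plane n) (i : Fin n) : Plane :=
  P ((finRotate n).symm i)

/-- A simple polygon: at least three vertices, all distinct, consecutive edges meet only in their
common vertex, and any other two edges are disjoint. -/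
structure Polygon.IsSimple {n : ℕ} (P : Polygon Plane n) : Prop where
  three_le : 3 ≤ n
  injective : Function.Injective P.vertices
  consecutive : ∀ i : Fin n, P.edgeSet ℝ i ∩ P.edgeSet ℝ (finRotate n i) = {P.next i}
  disjoint : ∀ i j : Fin n, i ≠ j → j ≠ finRotate n i → i ≠ finRotate n j →
    Disjoint (P.edgeSet ℝ i) (P.edgeSet ℝ j)

/-- The signed area enclosed by the polygon (shoelace formula). -/
def Polygon.signedArea {n : ℕ} (P : Polygon Plane n) : ℝ :=
  (∑ i : Fin n, cross (P i) (P.next i)) / 2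

/-- The vertices are listed in anti-clockwise order. -/
def Polygon.IsAnticlockwise {n : ℕ} (P : Polygon Plane n) : Prop :=
  0 < P.signedArea

open scoped Classical in
/-- The interior angle, in `[0, 2π]`, at the `i`-th vertex of a simple polygon whose vertices are
listed anti-clockwise: the angle between the two edges at that vertex if the boundary does not turn
right there, and the complementary reflex angle if it does. -/
def Polygon.interiorAngle {n : ℕ} (P : Polygon Plane n) (i : Fin n) : ℝ :=
  if 0 ≤ cross (P i - P.prev i) (P.next i - P i) then
    EuclideanGeometry.angle (P.prev i) (P i) (P.next i)
  else
    2 * Real.pi - EuclideanGeometry.angle (P.prev i) (P i) (P.next i)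

/-- The region enclosed by a polygon, without its boundary: the points off the boundary whose
connected component in the complement of the boundary is bounded. -/
def Polygon.inside {n : ℕ} (P : Polygon Plane n) : Set Plane :=
  {x | x ∉ P.boundary ℝ ∧ Bornology.IsBounded (connectedComponentIn (P.boundary ℝ)ᶜ x)}

/-- A pseudo-triangle: a simple polygon (listed anti-clockwise) with exactly three vertices at which
the interior angle is less than `π`. -/
structure Polygon.IsPseudoTriangle {n : ℕ} (P : Polygon Plane n) : Prop where
  simple : P.IsSimple
  anticlockwise : P.IsAnticlockwise
  convex_vertices : {i : Fin n | P.interiorAngle i < Real.pi}.ncard = 3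

/-- Some `l` points of `S` are the vertices of an `l`-pseudo-triangle. -/
def ContainsPseudoTriangle (S : Set Plane) (l : ℕ) : Prop :=
  ∃ P : Polygon Plane l, P.IsPseudoTriangle ∧ Set.range P.vertices ⊆ S

/-- Some `l` points of `S` are the vertices of an `l`-pseudo-triangle with no point of `S` in its
interior. -/
def ContainsEmptyPseudoTriangle (S : Set Plane) (l : ℕ) : Prop :=
  ∃ P : Polygon Plane l, P.IsPseudoTriangle ∧ Set.range P.vertices ⊆ S ∧ Disjoint P.inside S

end

/-! For (i), let `A B C` be the hull triangle. General position makes the interior points linearly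
ordered by angle around each corner. Divide them into three pockets `X`, `Y`, `Z` belonging to the
edges `A B`, `B C`, `C A`, such that at each corner the two adjacent pockets are separated
(`Pockets`). Removing from the triangle the convex hull of each pocket together with its edge leaves
a pseudo-triangle with corners `A`, `B`, `C` and no point of `S` in its interior. It has seven
vertices when two of the removed hulls are triangles and the third is a quadrilateral;
`contains_of_below` settles this case.

If two hulls are triangles and the third has more than four vertices, `contains_of_not_hasApex`
shrinks it. Let `x` be the point of `X` seen last from `A`. Either `x` replaces the corner `A`
(`cut`), or the mirror image of this happens at `B`, or `x` passes to `Z` and becomes its apex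
(`move`). The hull over `A B` never becomes a triangle, so induction on the number of points of `X`
must end with a quadrilateral. `contains_of_not_hasApex_of_nonempty` reduces to this a configuration
in which only the pocket over `C A` is known to be a triangle.

Five interior points allow a start with one point in each of `Y`, `Z` and three or more in `X`
(`contains_of_five_le`). If `X` spans a triangle, handing over its apex, and if necessary the next
apex too, produces a pocket that is not a triangle (`contains_of_singletons`).

For (ii), a set of three hull vertices and four interior points leaves a heptagon no choice but to
use all of them, so an explicit lattice example is checked by running through all orders of its
points (`sevenPoints_search`). -/

/-- Twice the signed area of the triangle `P Q R`, multiplied by `s`. With `s = 1` it is positive iff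
`P Q R` is anti-clockwise; with `s = -1` iff it is clockwise. -/
def orient (s : ℝ) (P Q R : Plane) : ℝ :=
  s * cross (Q - P) (R - P)

/-! ### Orientation identities and the angular order around a corner. -/

section OrientAlgebra

variable {s : ℝ} {A B C O P Q R T u v w : Plane}

theorem orient_eq (s : ℝ) (P Q R : Plane) :
    orient s P Q R = s * ((Q 0 - P 0) * (R 1 - P 1) - (Q 1 - P 1) * (R 0 - P 0)) := by
  simp [orient, cross]

theorem orient_rotate (s : ℝ) (P Q R : Plane) : orient s P Q R = orient s Q R P := by
  simp only [orient_eq]; ring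

theorem orient_swap (s : ℝ) (P Q R : Plane) : orient s P R Q = -orient s P Q R := by
  simp only [orient_eq]; ring

theorem orient_neg (s : ℝ) (P Q R : Plane) : orient (-s) P Q R = orient s P R Q := by
  simp only [orient_eq]; ring

@[simp]
theorem orient_self_left (s : ℝ) (P Q : Plane) : orient s P P Q = 0 := by
  simp only [orient_eq]; ring

@[simp]
theorem orient_self_right (s : ℝ) (P Q : Plane) : orient s P Q Q = 0 := by
  simp only [orient_eq]; ring

@[simp]
theorem orient_self_outer (s : ℝ) (P Q : Plane) : orient s P Q P = 0 := by
  simp only [orient_eq]; ring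

/-- The three-term Grassmann–Plücker relation. -/
theorem orient_plucker (s : ℝ) (O P Q R T : Plane) :
    orient s O P Q * orient s O R T - orient s O P R * orient s O Q T +
      orient s O P T * orient s O Q R = 0 := by
  simp only [orient_eq]; ring

/-- The barycentric relation for the functional `orient s · u v`, which vanishes at `u`. -/
theorem orient_barycentric (s : ℝ) (A B C u v : Plane) :
    orient s B C u * orient s A u v + orient s C A u * orient s B u v +
      orient s A B u * orient s C u v = 0 := by
  simp only [orient_eq]; ring

/-- The point `m` lies strictly inside the triangle `A B C`, whose orientation is given by `s`. -/
structure StrictlyInside (s : ℝ) (A B C m : Plane) : Prop where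
  ab : 0 < orient s A B m
  bc : 0 < orient s B C m
  ca : 0 < orient s C A m

theorem StrictlyInside.rotate {m : Plane} (h : StrictlyInside s A B C m) :
    StrictlyInside s B C A m := ⟨h.bc, h.ca, h.ab⟩

/-- Exchanging `A` and `B` reverses the triangle, and the sign of `s` compensates. Carrying `s`
along lets every mirror-image case be obtained from the case already proved. -/
theorem StrictlyInside.mirror {m : Plane} (h : StrictlyInside s A B C m) :
    StrictlyInside (-s) B A C m := by
  refine ⟨?_, ?_, ?_⟩ <;> rw [orient_neg, ← orient_rotate]
  exacts [h.ab, h.ca, h.bc]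

/-- The order in which the points inside a triangle appear around a vertex is transitive. -/
theorem orient_trans (hu : 0 < orient s A B u) (hv : 0 < orient s A B v) (hw : 0 < orient s A B w)
    (h₁ : 0 < orient s A u v) (h₂ : 0 < orient s A v w) : 0 < orient s A u w := by
  have h := orient_plucker s A B u v w
  have h₃ : 0 < orient s A B v * orient s A u w := by
    nlinarith [mul_pos hu h₂, mul_pos hw h₁]
  exact pos_of_mul_pos_right h₃ hv.le

/-- A line through an interior point has vertices of the triangle on both sides. -/
theorem StrictlyInside.orient_third (h : StrictlyInside s A B C u)
    (h₁ : 0 < orient s A u v) (h₂ : 0 < orient s B u v) : 0 < orient s C v u := by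
  have e := orient_barycentric s A B C u v
  rw [orient_swap]
  have h₃ : 0 < orient s A B u * -orient s C u v := by
    nlinarith [mul_pos h.bc h₁, mul_pos h.ca h₂]
  exact pos_of_mul_pos_right h₃ h.ab.le

end OrientAlgebra

/-! ### Pockets, their symmetries, and moving a point between them. -/

/-- `t` is a point of `X` such that the triangle `A B t` contains all other points of `X`. -/
def IsApex (s : ℝ) (A B : Plane) (X : Set Plane) (t : Plane) : Prop :=
  t ∈ X ∧ ∀ m ∈ X, m ≠ t → 0 < orient s A m t ∧ 0 < orient s B t m

/-- The pocket over `A B` spanned by `X` is a triangle. -/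
def HasApex (s : ℝ) (A B : Plane) (X : Set Plane) : Prop :=
  ∃ t, IsApex s A B X t

/-- The points of `S` strictly inside the triangle `A B C` are divided into three sets whose convex
hulls with the edges `A B`, `B C`, `C A`, respectively, overlap only in `A`, `B`, `C`: seen from each
vertex, the two sets at that vertex are separated. -/
structure Pockets (S : Set Plane) (s : ℝ) (A B C : Plane) (X Y Z : Set Plane) : Prop where
  s_ne : s ≠ 0
  memA : A ∈ S
  memB : B ∈ S
  memC : C ∈ S
  pos : 0 < orient s A B C
  subX : X ⊆ S
  subY : Y ⊆ S
  subZ : Z ⊆ S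
  insX : ∀ m ∈ X, StrictlyInside s A B C m
  insY : ∀ m ∈ Y, StrictlyInside s A B C m
  insZ : ∀ m ∈ Z, StrictlyInside s A B C m
  cover : ∀ m ∈ S, StrictlyInside s A B C m → m ∈ X ∨ m ∈ Y ∨ m ∈ Z
  sepA : ∀ x ∈ X, ∀ z ∈ Z, 0 < orient s A x z
  sepB : ∀ y ∈ Y, ∀ x ∈ X, 0 < orient s B y x
  sepC : ∀ z ∈ Z, ∀ y ∈ Y, 0 < orient s C z y

section Tops

variable {s : ℝ} {A B C t u v : Plane} {X : Set Plane}

theorem orient_asymm (h : 0 < orient s A u v) : ¬ 0 < orient s A v u := by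
  rw [orient_swap]; linarith

theorem ne_of_orient_pos (h : 0 < orient s A u v) : u ≠ v := by
  rintro rfl; simp at h

theorem IsApex.mirror (h : IsApex s A B X t) : IsApex (-s) B A X t := by
  refine ⟨h.1, fun m hm hmt => ?_⟩
  rw [orient_neg, orient_neg]
  exact (h.2 m hm hmt).symm

theorem hasApex_singleton (s : ℝ) (A B t : Plane) : HasApex s A B {t} :=
  ⟨t, rfl, fun _ hm hmt => absurd hm hmt⟩

end Tops

namespace Pockets

variable {S : Set Plane} {s : ℝ} {A B C t u v x y z q r m : Plane} {X Y Z : Set Plane}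

theorem rotate (h : Pockets S s A B C X Y Z) : Pockets S s B C A Y Z X where
  s_ne := h.s_ne
  memA := h.memB
  memB := h.memC
  memC := h.memA
  pos := by rw [← orient_rotate]; exact h.pos
  subX := h.subY
  subY := h.subZ
  subZ := h.subX
  insX m hm := (h.insY m hm).rotate
  insY m hm := (h.insZ m hm).rotate
  insZ m hm := (h.insX m hm).rotate
  cover m hm hi := by
    rcases h.cover m hm hi.rotate.rotate with h' | h' | h' <;> tauto
  sepA := h.sepB
  sepB := h.sepC
  sepC := h.sepA

theorem mirror (h : Pockets S s A B C X Y Z) : Pockets S (-s) B A C X Z Y where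
  s_ne := neg_ne_zero.2 h.s_ne
  memA := h.memB
  memB := h.memA
  memC := h.memC
  pos := by rw [orient_neg, ← orient_rotate]; exact h.pos
  subX := h.subX
  subY := h.subZ
  subZ := h.subY
  insX m hm := (h.insX m hm).mirror
  insY m hm := (h.insZ m hm).mirror
  insZ m hm := (h.insY m hm).mirror
  cover m hm hi := by
    have hi' := hi.mirror
    rw [neg_neg] at hi'
    rcases h.cover m hm hi' with h' | h' | h' <;> tauto
  sepA a ha b hb := by rw [orient_neg]; exact h.sepB b hb a ha
  sepB a ha b hb := by rw [orient_neg]; exact h.sepA b hb a ha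
  sepC a ha b hb := by rw [orient_neg]; exact h.sepC b hb a ha

/-- Move a point, the last one seen from `A`, from the first set to the third one. -/
theorem move (h : Pockets S s A B C X Y Z) (hx : x ∈ X)
    (hlast : ∀ m ∈ X, m ≠ x → 0 < orient s A m x) (hC : ∀ y ∈ Y, 0 < orient s C x y) :
    Pockets S s A B C (X \ {x}) Y (insert x Z) where
  s_ne := h.s_ne
  memA := h.memA
  memB := h.memB
  memC := h.memC
  pos := h.pos
  subX := Set.sdiff_subset.trans h.subX
  subY := h.subY
  subZ := Set.insert_subset (h.subX hx) h.subZ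
  insX m hm := h.insX m hm.1
  insY := h.insY
  insZ := by
    rintro m (rfl | hm)
    exacts [h.insX _ hx, h.insZ m hm]
  cover m hm hi := by
    by_cases hmx : m = x
    · simp [hmx]
    · rcases h.cover m hm hi with h' | h' | h' <;> simp [h', hmx]
  sepA := by
    rintro a ⟨ha, hax⟩ b (rfl | hb)
    exacts [hlast a ha hax, h.sepA a ha b hb]
  sepB y hy x hx := h.sepB y hy x hx.1
  sepC := by
    rintro a (rfl | ha) b hb
    exacts [hC b hb, h.sepC a ha b hb]

/-- Move a point, the first one seen from `B`, from the first set to the second one. -/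
theorem move' (h : Pockets S s A B C X Y Z) (hy : y ∈ X)
    (hfirst : ∀ m ∈ X, m ≠ y → 0 < orient s B y m) (hC : ∀ z ∈ Z, 0 < orient s C z y) :
    Pockets S s A B C (X \ {y}) (insert y Y) Z := by
  have h' := (h.mirror.move hy (fun m hm hmy => by rw [orient_neg]; exact hfirst m hm hmy)
    (fun z hz => by rw [orient_neg]; exact hC z hz)).mirror
  rwa [neg_neg] at h'

theorem trans_C (hu : StrictlyInside s A B C u) (hv : StrictlyInside s A B C v)
    (ht : StrictlyInside s A B C t) (h₁ : 0 < orient s C u v) (h₂ : 0 < orient s C v t) :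
    0 < orient s C u t := orient_trans hu.ca hv.ca ht.ca h₁ h₂

end Pockets

/-! ### Extreme points of a pocket, and how apexes behave under cutting and moving. -/

/-- No three distinct points of `S` have vanishing orientation. -/
def NoThreeAligned (S : Set Plane) : Prop :=
  ∀ a ∈ S, ∀ b ∈ S, ∀ c ∈ S, a ≠ b → a ≠ c → b ≠ c → orient 1 a b c ≠ 0

namespace Pockets

variable {S : Set Plane} {s : ℝ} {A B C t u v x y z q r m : Plane} {X Y Z : Set Plane}

theorem ne_A (h : StrictlyInside s A B C m) : m ≠ A := by
  rintro rfl; simpa using h.ab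

theorem ne_B (h : StrictlyInside s A B C m) : m ≠ B := ne_A h.rotate

theorem ne_C (h : StrictlyInside s A B C m) : m ≠ C := ne_B h.rotate

theorem orient_total (hS : NoThreeAligned S) (hs : s ≠ 0) (hA : A ∈ S) (hu : u ∈ S) (hv : v ∈ S)
    (hAu : A ≠ u) (hAv : A ≠ v) (huv : u ≠ v) : 0 < orient s A u v ∨ 0 < orient s A v u := by
  have h : orient s A u v ≠ 0 := by
    have h := hS A hA u hu v hv hAu hAv huv
    rw [orient_eq, one_mul] at h
    rw [orient_eq]
    exact mul_ne_zero hs h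
  rw [orient_swap s A u v]
  rcases h.lt_or_gt with h | h
  · right; linarith
  · left; exact h

/-- Among finitely many points inside a triangle there is a last one, seen from `A`. -/
theorem exists_last (hS : NoThreeAligned S) (hs : s ≠ 0) (hA : A ∈ S) (hpos : 0 < orient s A B C)
    (hXS : X ⊆ S) (hins : ∀ m ∈ X, StrictlyInside s A B C m) (hfin : X.Finite) (hne : X.Nonempty) :
    ∃ x ∈ X, ∀ m ∈ X, m ≠ x → 0 < orient s A m x := by
  -- The ratio of the areas over `A B` and `C A` increases with the angle at `A` measured from `A
  -- B`.
  obtain ⟨x, hx, hmax⟩ :=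
    Set.exists_max_image X (fun m => orient s A B m / orient s C A m) hfin hne
  refine ⟨x, hx, fun m hm hmx => ?_⟩
  have hi := hins m hm
  have hix := hins x hx
  refine (orient_total hS hs hA (hXS hm) (hXS hx) (ne_A hi).symm (ne_A hix).symm hmx).resolve_right
    fun hlt => ?_
  have hle := hmax m hm
  rw [div_le_div_iff₀ hi.ca hix.ca] at hle
  have e := orient_plucker s A B C x m
  have e₁ : orient s C A m = -orient s A C m := by rw [orient_rotate, orient_swap]
  have e₂ : orient s C A x = -orient s A C x := by rw [orient_rotate, orient_swap]
  rw [e₁, e₂] at hle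
  nlinarith [mul_pos hpos hlt]

theorem exists_first (hS : NoThreeAligned S) (hs : s ≠ 0) (hB : B ∈ S) (hpos : 0 < orient s A B C)
    (hXS : X ⊆ S) (hins : ∀ m ∈ X, StrictlyInside s A B C m) (hfin : X.Finite) (hne : X.Nonempty) :
    ∃ y ∈ X, ∀ m ∈ X, m ≠ y → 0 < orient s B y m := by
  obtain ⟨y, hy, h⟩ := exists_last hS (neg_ne_zero.2 hs) hB
    (C := C) (by rw [orient_neg, ← orient_rotate]; exact hpos) hXS
    (fun m hm => (hins m hm).mirror) hfin hne
  exact ⟨y, hy, fun m hm hmy => by have := h m hm hmy; rwa [orient_neg] at this⟩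

/-- Positive combinations of barycentric coordinates stay positive. This ensures that every point of
`S` inside a cut-down triangle was already in one of the pockets. -/
theorem strictlyInside_of_subtriangle (hx : StrictlyInside s A B C x) (hpos : 0 < orient s A B C)
    (hm : StrictlyInside s x B C m) : StrictlyInside s A B C m := by
  have hxBC : 0 < orient s x B C := by rw [orient_rotate]; exact hx.bc
  refine ⟨?_, hm.bc, ?_⟩
  · have e : orient s x B C * orient s A B m =
        orient s A B x * orient s B C m + orient s A B C * orient s x B m := by
      simp only [orient_eq]; ring
    refine pos_of_mul_pos_right (a := orient s x B C) ?_ hxBC.le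
    rw [e]
    exact add_pos (mul_pos hx.ab hm.bc) (mul_pos hpos hm.ab)
  · have e : orient s x B C * orient s C A m =
        orient s C A x * orient s B C m + orient s A B C * orient s C x m := by
      simp only [orient_eq]; ring
    refine pos_of_mul_pos_right (a := orient s x B C) ?_ hxBC.le
    rw [e]
    exact add_pos (mul_pos hx.ca hm.bc) (mul_pos hpos hm.ca)

/-- Cut the triangle down to `x B C`, where `x` is the last point of the first set, seen from `A`. -/
theorem cut (h : Pockets S s A B C X Y Z) (hx : x ∈ X)
    (hlast : ∀ m ∈ X, m ≠ x → 0 < orient s A m x) (hr : IsApex s C A Z r)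
    (hxr : 0 < orient s C x r) :
    Pockets S s x B C {m ∈ X | 0 < orient s B m x} Y {z ∈ Z | 0 < orient s C x z} where
  s_ne := h.s_ne
  memA := h.subX hx
  memB := h.memB
  memC := h.memC
  pos := by rw [orient_rotate]; exact (h.insX x hx).bc
  subX := (Set.sep_subset _ _).trans h.subX
  subY := h.subY
  subZ := (Set.sep_subset _ _).trans h.subZ
  insX m hm := by
    refine ⟨by rw [orient_rotate]; exact hm.2, (h.insX m hm.1).bc, ?_⟩
    exact (h.insX m hm.1).orient_third (hlast m hm.1 (ne_of_orient_pos hm.2)) hm.2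
  insY m hm := by
    refine ⟨by rw [orient_rotate]; exact h.sepB m hm x hx, (h.insY m hm).bc, ?_⟩
    exact trans_C (h.insX x hx) (h.insZ r hr.1) (h.insY m hm) hxr (h.sepC r hr.1 m hm)
  insZ m hm := by
    refine ⟨?_, (h.insZ m hm.1).bc, hm.2⟩
    rw [orient_rotate]
    exact (h.insX x hx).rotate.rotate.orient_third hm.2 (h.sepA x hx m hm.1)
  cover m hm hi := by
    rcases h.cover m hm (strictlyInside_of_subtriangle (h.insX x hx) h.pos hi) with h' | h' | h'
    · exact Or.inl ⟨h', by rw [← orient_rotate]; exact hi.ab⟩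
    · exact Or.inr (Or.inl h')
    · exact Or.inr (Or.inr ⟨h', hi.ca⟩)
  sepA m hm z hz := by
    have h₁ := hlast m hm.1 (ne_of_orient_pos hm.2)
    have h₂ := (h.insX m hm.1).orient_third h₁ hm.2
    have e : orient s C A x * orient s x m z =
        orient s A m x * orient s C x z + orient s C x m * orient s A x z := by
      simp only [orient_eq]; ring
    refine pos_of_mul_pos_right (a := orient s C A x) ?_ (h.insX x hx).ca.le
    rw [e]
    exact add_pos (mul_pos h₁ hz.2) (mul_pos h₂ (h.sepA x hx z hz.1))
  sepB y hy m hm := h.sepB y hy m hm.1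
  sepC z hz y hy := h.sepC z hz.1 y hy

theorem isApex_cut (h : Pockets S s A B C X Y Z) (hx : x ∈ X) (hr : IsApex s C A Z r)
    (hxr : 0 < orient s C x r) : IsApex s C x {z ∈ Z | 0 < orient s C x z} r := by
  refine ⟨⟨hr.1, hxr⟩, fun z hz hzr => ?_⟩
  obtain ⟨h₁, h₂⟩ := hr.2 z hz.1 hzr
  refine ⟨h₁, ?_⟩
  have e : orient s C A r * orient s x r z =
      orient s A x r * orient s C z r + orient s C x r * orient s A r z := by
    simp only [orient_eq]; ring
  refine pos_of_mul_pos_right (a := orient s C A r) ?_ (h.insZ r hr.1).ca.le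
  rw [e]
  exact add_pos (mul_pos (h.sepA x hx r hr.1) h₁) (mul_pos hxr h₂)

/-- From `C`, the point `x` comes after `r` and hence after all of `Z`; from `A`, it comes before
all of `Z` by separation. -/
theorem isApex_insert (h : Pockets S s A B C X Y Z) (hx : x ∈ X) (hr : IsApex s C A Z r)
    (hrx : 0 < orient s C r x) : IsApex s C A (insert x Z) x := by
  refine ⟨Set.mem_insert _ _, fun m hm hmx => ?_⟩
  have hm : m ∈ Z := hm.resolve_left hmx
  refine ⟨?_, h.sepA x hx m hm⟩
  by_cases hmr : m = r
  · rwa [hmr]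
  · exact trans_C (h.insZ m hm) (h.insZ r hr.1) (h.insX x hx) (hr.2 m hm hmr).1 hrx

/-- A point that is both last from `A` and first from `B` would be an apex. Nonemptiness is a
separate hypothesis because the empty pocket has no apex either. -/
theorem exists_last_first (h : Pockets S s A B C X Y Z) (hS : NoThreeAligned S) (hfin : S.Finite)
    (hne : X.Nonempty) (hX : ¬ HasApex s A B X) :
    ∃ x ∈ X, ∃ y ∈ X, x ≠ y ∧ (∀ m ∈ X, m ≠ x → 0 < orient s A m x) ∧
      ∀ m ∈ X, m ≠ y → 0 < orient s B y m := by
  obtain ⟨x, hx, hlast⟩ := exists_last hS h.s_ne h.memA h.pos h.subX h.insX (hfin.subset h.subX) hne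
  obtain ⟨y, hy, hfirst⟩ :=
    exists_first hS h.s_ne h.memB h.pos h.subX h.insX (hfin.subset h.subX) hne
  refine ⟨x, hx, y, hy, ?_, hlast, hfirst⟩
  rintro rfl
  exact hX ⟨x, hx, fun m hm hmx => ⟨hlast m hm hmx, hfirst m hm hmx⟩⟩

/-- The points of `X` seen last from `A` and first from `B`, together with a point beyond the line
through them, leave no apex when the first of them is removed. -/
theorem not_hasApex_sdiff (h : Pockets S s A B C X Y Z) (hy : y ∈ X) (hm : m ∈ X)
    (hfirst : ∀ m ∈ X, m ≠ y → 0 < orient s B y m) (hAyx : 0 < orient s A y x)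
    (hByx : 0 < orient s B y x) (hxym : 0 < orient s x y m) : ¬ HasApex s A B (X \ {x}) := by
  have hmy : m ≠ y := (ne_of_orient_pos hxym).symm
  have hmx : m ≠ x := by rintro rfl; simp at hxym
  rintro ⟨t, ht, htop⟩
  have hyx : y ≠ x := ne_of_orient_pos hAyx
  have hty : t = y := by
    by_contra hty
    exact orient_asymm (htop y ⟨hy, hyx⟩ (Ne.symm hty)).2 (hfirst t ht.1 hty)
  subst hty
  refine orient_asymm (htop m ⟨hm, hmx⟩ hmy).1 ?_
  have e : orient s B t x * orient s A t m =
      orient s x t m * orient s A B t + orient s B t m * orient s A t x := by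
    simp only [orient_eq]; ring
  refine pos_of_mul_pos_right (a := orient s B t x) ?_ hByx.le
  rw [e]
  exact add_pos (mul_pos hxym (h.insX t hy).ab) (mul_pos (hfirst m hm hmy) hAyx)

/-- Both `y` and `m` survive the cut. Since `y` is still first from `B`, it is the only candidate
for an apex, and `m` beyond the line `x y` rules it out. -/
theorem not_hasApex_cut (h : Pockets S s A B C X Y Z) (hx : x ∈ X) (hy : y ∈ X) (hm : m ∈ X)
    (hlast : ∀ m ∈ X, m ≠ x → 0 < orient s A m x)
    (hfirst : ∀ m ∈ X, m ≠ y → 0 < orient s B y m) (hxy : x ≠ y)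
    (hxym : 0 < orient s x y m) : ¬ HasApex s x B {m ∈ X | 0 < orient s B m x} := by
  have hmy : m ≠ y := (ne_of_orient_pos hxym).symm
  have hmx : m ≠ x := by rintro rfl; simp at hxym
  have hAyx := hlast y hy hxy.symm
  have hByx := hfirst x hx hxy
  have hBmx : 0 < orient s B m x := by
    have e : orient s A y x * orient s B m x =
        orient s x y m * orient s A B x + orient s A m x * orient s B y x := by
      simp only [orient_eq]; ring
    refine pos_of_mul_pos_right (a := orient s A y x) ?_ hAyx.le
    rw [e]
    exact add_pos (mul_pos hxym (h.insX x hx).ab) (mul_pos (hlast m hm hmx) hByx)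
  rintro ⟨t, ht, htop⟩
  have hty : t = y := by
    by_contra hty
    exact orient_asymm (htop y ⟨hy, hByx⟩ (Ne.symm hty)).2 (hfirst t ht.1 hty)
  subst hty
  exact orient_asymm (htop m ⟨hm, hBmx⟩ hmy).1 hxym

end Pockets

/-! ### Separating segments by lines, and rays that avoid segments. -/

section Segments

variable {s : ℝ} {O P Q R T U V m : Plane}

theorem orient_lineMap (s : ℝ) (U V P Q : Plane) (t : ℝ) :
    orient s U V (AffineMap.lineMap P Q t) = (1 - t) * orient s U V P + t * orient s U V Q := by
  simp only [orient_eq, AffineMap.lineMap_apply, vsub_eq_sub, vadd_eq_add, PiLp.add_apply,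
    PiLp.smul_apply, PiLp.sub_apply, smul_eq_mul]
  ring

theorem orient_nonpos_of_mem_affineSegment (hm : m ∈ affineSegment ℝ P Q)
    (hP : orient s U V P ≤ 0) (hQ : orient s U V Q ≤ 0) : orient s U V m ≤ 0 := by
  obtain ⟨t, ⟨h0, h1⟩, rfl⟩ := hm
  rw [orient_lineMap]
  nlinarith

theorem orient_pos_of_mem_affineSegment (hm : m ∈ affineSegment ℝ P Q)
    (hP : 0 < orient s U V P) (hQ : 0 < orient s U V Q) : 0 < orient s U V m := by
  obtain ⟨t, ⟨h0, h1⟩, rfl⟩ := hm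
  rw [orient_lineMap]
  rcases h0.eq_or_lt with rfl | h0
  · simpa using hP
  · nlinarith [mul_pos h0 hQ]

/-- Two segments on different sides of the line `U V` are disjoint. -/
theorem disjoint_affineSegment (U V : Plane) (hP : orient s U V P ≤ 0) (hQ : orient s U V Q ≤ 0)
    (hR : 0 < orient s U V R) (hT : 0 < orient s U V T) :
    Disjoint (affineSegment ℝ P Q) (affineSegment ℝ R T) :=
  Set.disjoint_left.2 fun _ h₁ h₂ => (orient_nonpos_of_mem_affineSegment h₁ hP hQ).not_gt
    (orient_pos_of_mem_affineSegment h₂ hR hT)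

theorem affineSegment_inter_affineSegment (h : orient s P Q R ≠ 0) :
    affineSegment ℝ P Q ∩ affineSegment ℝ Q R = {Q} := by
  refine Set.Subset.antisymm ?_ ?_
  · rintro m ⟨⟨u, -, hu⟩, ⟨t, -, rfl⟩⟩
    have h₁ := orient_lineMap s P Q P Q u
    have h₂ := orient_lineMap s P Q Q R t
    rw [hu, h₂] at h₁
    have ht : t = 0 := by simpa [h] using h₁
    simp [ht]
  · rintro _ rfl
    exact ⟨right_mem_affineSegment ℝ P _, left_mem_affineSegment ℝ _ R⟩

/-- A ray that starts on the positive side of the line `U V` and leads away from a point on the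
other side avoids all segments on that other side. -/
theorem ray_notMem_affineSegment (U V : Plane) (hm : 0 < orient s U V m) (hO : orient s U V O ≤ 0)
    (hP : orient s U V P ≤ 0) (hQ : orient s U V Q ≤ 0) {t : ℝ} (ht : 0 ≤ t) :
    m + t • (m - O) ∉ affineSegment ℝ P Q := by
  intro h
  have h₁ := orient_nonpos_of_mem_affineSegment h hP hQ
  have h₂ : orient s U V (m + t • (m - O)) = (1 + t) * orient s U V m - t * orient s U V O := by
    simp only [orient_eq, PiLp.add_apply, PiLp.smul_apply, PiLp.sub_apply, smul_eq_mul]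
    ring
  nlinarith

end Segments

/-! ### Inside, interior angles and simplicity of polygons. -/

namespace Polygon

variable {n : ℕ} {P : Polygon Plane n}

theorem notMem_inside_of_mem_range {m : Plane} (h : m ∈ Set.range P.vertices) : m ∉ P.inside := by
  obtain ⟨i, rfl⟩ := h
  exact fun h => h.1 (Set.mem_iUnion.2 ⟨i, left_mem_affineSegment ..⟩)

/-- A point from which a ray leads to infinity off the boundary is not inside the polygon. -/
theorem notMem_inside_of_ray {m v : Plane} (hv : v ≠ 0)
    (h : ∀ t : ℝ, 0 ≤ t → m + t • v ∉ P.boundary ℝ) : m ∉ P.inside := by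
  rintro ⟨-, hb⟩
  have hpre : IsPreconnected ((fun t : ℝ => m + t • v) '' Set.Ici 0) :=
    isPreconnected_Ici.image _ (by fun_prop)
  have hsub := hpre.subset_connectedComponentIn (x := m) (F := (P.boundary ℝ)ᶜ)
    ⟨0, Set.mem_Ici.2 le_rfl, by simp⟩ (by rintro _ ⟨t, ht, rfl⟩; exact h t ht)
  obtain ⟨K, hK⟩ := (hb.subset hsub).exists_norm_le
  have hv' : 0 < ‖v‖ := norm_pos_iff.2 hv
  have hK0 : 0 ≤ K := (norm_nonneg _).trans (hK m ⟨0, Set.mem_Ici.2 le_rfl, by simp⟩)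
  -- At this parameter the ray is at distance `K + ‖m‖ + 1` from `m`, hence outside the ball of
  -- radius `K` that bounds the component.
  have ht : 0 ≤ (K + ‖m‖ + 1) / ‖v‖ := by positivity
  have h₁ := hK _ ⟨_, Set.mem_Ici.2 ht, rfl⟩
  have h₂ : ‖((K + ‖m‖ + 1) / ‖v‖) • v‖ = K + ‖m‖ + 1 := by
    rw [norm_smul, Real.norm_of_nonneg ht, div_mul_cancel₀ _ hv'.ne']
  have h₃ := norm_sub_le (m + ((K + ‖m‖ + 1) / ‖v‖) • v) m
  rw [add_sub_cancel_left, h₂] at h₃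
  linarith

/-- Without collinearity the unoriented angle is strictly below `π`, so the direction of the turn
alone decides. -/
theorem interiorAngle_lt_pi_iff {i : Fin n} (h : orient 1 (P.prev i) (P i) (P.next i) ≠ 0) :
    P.interiorAngle i < Real.pi ↔ 0 < orient 1 (P.prev i) (P i) (P.next i) := by
  have e : cross (P i - P.prev i) (P.next i - P i) = orient 1 (P.prev i) (P i) (P.next i) := by
    simp only [orient, cross, PiLp.sub_apply]; ring
  have hlt : EuclideanGeometry.angle (P.prev i) (P i) (P.next i) < Real.pi := by
    refine (EuclideanGeometry.angle_le_pi _ _ _).lt_of_ne fun hpi => h ?_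
    rw [EuclideanGeometry.angle, InnerProductGeometry.angle_eq_pi_iff] at hpi
    obtain ⟨-, r, -, hr⟩ := hpi
    have h0 := congrArg (fun z : Plane => z 0) hr
    have h1 := congrArg (fun z : Plane => z 1) hr
    simp only [vsub_eq_sub, PiLp.sub_apply, PiLp.smul_apply, smul_eq_mul] at h0 h1
    rw [← e, cross]
    simp only [PiLp.sub_apply]
    rw [h0, h1]; ring
  rw [interiorAngle, e]
  split_ifs with hc
  · exact ⟨fun _ => lt_of_le_of_ne hc h.symm, fun _ => hlt⟩
  · constructor
    · intro h'; linarith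
    · intro h'; exact absurd h'.le hc

end Polygon

/-- Simplicity of a heptagon from the pairwise disjointness of non-adjacent edges. -/
theorem isSimple_heptagon {a b c d e f g : Plane}
    (habc : orient 1 a b c ≠ 0) (hbcd : orient 1 b c d ≠ 0) (hcde : orient 1 c d e ≠ 0)
    (hdef : orient 1 d e f ≠ 0) (hefg : orient 1 e f g ≠ 0) (hfga : orient 1 f g a ≠ 0)
    (hgab : orient 1 g a b ≠ 0)
    (hac : Disjoint (affineSegment ℝ a b) (affineSegment ℝ c d))
    (had : Disjoint (affineSegment ℝ a b) (affineSegment ℝ d e))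
    (hae : Disjoint (affineSegment ℝ a b) (affineSegment ℝ e f))
    (haf : Disjoint (affineSegment ℝ a b) (affineSegment ℝ f g))
    (hbd : Disjoint (affineSegment ℝ b c) (affineSegment ℝ d e))
    (hbe : Disjoint (affineSegment ℝ b c) (affineSegment ℝ e f))
    (hbf : Disjoint (affineSegment ℝ b c) (affineSegment ℝ f g))
    (hbg : Disjoint (affineSegment ℝ b c) (affineSegment ℝ g a))
    (hce : Disjoint (affineSegment ℝ c d) (affineSegment ℝ e f))
    (hcf : Disjoint (affineSegment ℝ c d) (affineSegment ℝ f g))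
    (hcg : Disjoint (affineSegment ℝ c d) (affineSegment ℝ g a))
    (hdf : Disjoint (affineSegment ℝ d e) (affineSegment ℝ f g))
    (hdg : Disjoint (affineSegment ℝ d e) (affineSegment ℝ g a))
    (heg : Disjoint (affineSegment ℝ e f) (affineSegment ℝ g a)) :
    (⟨![a, b, c, d, e, f, g]⟩ : Polygon Plane 7).IsSimple := by
  set P : Polygon Plane 7 := ⟨![a, b, c, d, e, f, g]⟩ with hP
  have key : ∀ i j : Fin 7, i < j → j ≠ finRotate 7 i → i ≠ finRotate 7 j →
      Disjoint (P.edgeSet ℝ i) (P.edgeSet ℝ j) := by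
    intro i j h₁ h₂ h₃
    fin_cases i <;> fin_cases j <;>
      first
      | exact absurd h₁ (by decide)
      | exact absurd rfl h₂
      | exact absurd rfl h₃
      | assumption
  have disj : ∀ i j : Fin 7, i ≠ j → j ≠ finRotate 7 i → i ≠ finRotate 7 j →
      Disjoint (P.edgeSet ℝ i) (P.edgeSet ℝ j) := by
    intro i j hij h₁ h₂
    rcases hij.lt_or_gt with h | h
    · exact key i j h h₁ h₂
    · exact (key j i h h₂ h₁).symm
  have adj : ∀ i : Fin 7, P i ≠ P (finRotate 7 i) := by
    have hne : ∀ {u v w : Plane}, orient 1 u v w ≠ 0 → u ≠ v := by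
      rintro u _ w h rfl; simp at h
    intro i
    fin_cases i
    exacts [hne habc, hne hbcd, hne hcde, hne hdef, hne hefg, hne hfga, hne hgab]
  refine ⟨by norm_num, fun i j hij => ?_, fun i => ?_, disj⟩
  -- Equal vertices at non-adjacent positions would be a common point of the two disjoint edges
  -- starting there.
  · by_contra hne
    by_cases h₁ : j = finRotate 7 i
    · exact adj i (h₁ ▸ hij)
    by_cases h₂ : i = finRotate 7 j
    · exact adj j (h₂ ▸ hij.symm)
    refine Set.disjoint_left.1 (disj i j hne h₁ h₂) (left_mem_affineSegment ℝ (P i) _) ?_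
    rw [hij]
    exact left_mem_affineSegment ℝ (P j) _
  · fin_cases i
    exacts [affineSegment_inter_affineSegment habc, affineSegment_inter_affineSegment hbcd,
      affineSegment_inter_affineSegment hcde, affineSegment_inter_affineSegment hdef,
      affineSegment_inter_affineSegment hefg, affineSegment_inter_affineSegment hfga,
      affineSegment_inter_affineSegment hgab]

/-! ### The heptagon `A x y B q C r` as a pseudo-triangle. -/

/-- Three triangles over the edges of `A B C` that do not overlap leave positive area. -/
theorem hexagon_area_pos {A B C p q r : Plane} (hp : StrictlyInside 1 A B C p)
    (hq : StrictlyInside 1 A B C q) (hr : StrictlyInside 1 A B C r) (hA : 0 < orient 1 A p r)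
    (hB : 0 < orient 1 B q p) (hC : 0 < orient 1 C r q) :
    0 < orient 1 p q r + orient 1 A p r + orient 1 B q p + orient 1 C r q := by
  -- The sum is twice the area of the hexagon `A p B q C r`. Either `p q r` is anti-clockwise, or at
  -- some corner the quadrilateral formed by that corner and `p`, `q`, `r` splits along its diagonal
  -- from the corner into two triangles of nonnegative area.
  rcases le_or_gt 0 (orient 1 C r p) with h₁ | h₁
  · rcases le_or_gt 0 (orient 1 C p q) with h₂ | h₂
    · have e : orient 1 p q r + orient 1 A p r + orient 1 B q p + orient 1 C r q =
          orient 1 A p r + orient 1 B q p + orient 1 C r p + orient 1 C p q := by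
        simp only [orient_eq]; ring
      linarith
    · have h₃ : 0 < orient 1 A p q := hq.rotate.orient_third hB (by rw [orient_swap]; linarith)
      rcases le_or_gt 0 (orient 1 A q r) with h₄ | h₄
      · have e : orient 1 p q r + orient 1 A p r + orient 1 B q p + orient 1 C r q =
            orient 1 A p q + orient 1 A q r + orient 1 B q p + orient 1 C r q := by
          simp only [orient_eq]; ring
        linarith
      · have h₅ : 0 < orient 1 A r q := by rw [orient_swap]; linarith
        have e : orient 1 C A r * orient 1 p q r =
            orient 1 A p r * orient 1 C r q + orient 1 C r p * orient 1 A r q := by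
          simp only [orient_eq]; ring
        have h₆ : 0 < orient 1 p q r := by
          refine pos_of_mul_pos_right (a := orient 1 C A r) ?_ hr.ca.le
          rw [e]
          exact add_pos_of_pos_of_nonneg (mul_pos hA hC) (mul_nonneg h₁ h₅.le)
        linarith
  · have h₂ : 0 < orient 1 C p r := by rw [orient_swap]; linarith
    have h₃ : 0 < orient 1 B r p := hp.rotate.rotate.orient_third h₂ hA
    rcases le_or_gt 0 (orient 1 B q r) with h₄ | h₄
    · have e : orient 1 p q r + orient 1 A p r + orient 1 B q p + orient 1 C r q =
          orient 1 A p r + orient 1 B r p + orient 1 B q r + orient 1 C r q := by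
        simp only [orient_eq]; ring
      linarith
    · have h₅ : 0 < orient 1 B r q := by rw [orient_swap]; linarith
      have h₆ : 0 < orient 1 C p q := orient_trans hp.ca hr.ca hq.ca h₂ hC
      have e : orient 1 B C q * orient 1 p q r =
          orient 1 B q p * orient 1 C r q + orient 1 C p q * orient 1 B r q := by
        simp only [orient_eq]; ring
      have h₇ : 0 < orient 1 p q r := by
        refine pos_of_mul_pos_right (a := orient 1 B C q) ?_ hq.bc.le
        rw [e]
        exact add_pos (mul_pos hB hC) (mul_pos h₆ h₅)
      linarith

/-- The vertices `A x y B q C r` of a pseudo-triangle with corners `A`, `B`, `C`, in anti-clockwise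
order. -/
structure HeptagonData (A B C x y q r : Plane) : Prop where
  insx : StrictlyInside 1 A B C x
  insy : StrictlyInside 1 A B C y
  insq : StrictlyInside 1 A B C q
  insr : StrictlyInside 1 A B C r
  pos : 0 < orient 1 A B C
  Ayx : 0 < orient 1 A y x
  Byx : 0 < orient 1 B y x
  Axr : 0 < orient 1 A x r
  Bqy : 0 < orient 1 B q y
  Crq : 0 < orient 1 C r q

namespace HeptagonData

variable {A B C x y q r : Plane}

/-- The sum is twice the area, fanned from `A`. Extending `A x` and `B y` to their intersection `p`
replaces the quadrilateral pocket by the larger triangle `A B p`, so the heptagon exceeds the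
hexagon `A p B q C r` by the triangle `x y p`. -/
theorem area_pos (h : HeptagonData A B C x y q r) :
    0 < orient 1 A x y + orient 1 A y B + orient 1 A B q + orient 1 A q C + orient 1 A C r := by
  have hByA : 0 < orient 1 B y A := by rw [← orient_rotate]; exact h.insy.ab
  -- This makes the denominator of `l` positive, so that `p` lies beyond `x` on the ray from `A`.
  have hlt : orient 1 B y x < orient 1 B y A := by
    have e : orient 1 A B C * orient 1 B y x =
        orient 1 B C x * orient 1 B y A - orient 1 A B x * orient 1 B C y := by
      simp only [orient_eq]; ring
    have e' : orient 1 A B C = orient 1 B C x + orient 1 C A x + orient 1 A B x := by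
      simp only [orient_eq]; ring
    nlinarith [mul_pos h.insx.ab h.insy.bc, mul_pos h.insx.ab hByA, mul_pos h.insx.ca hByA, h.pos]
  -- the intersection of the lines `A x` and `B y`
  obtain ⟨l, hl⟩ : ∃ l, l = orient 1 B y A / (orient 1 B y A - orient 1 B y x) := ⟨_, rfl⟩
  have hl1 : 1 < l := by
    rw [hl, one_lt_div (by linarith)]
    linarith [h.Byx]
  have hl' : l * (orient 1 B y A - orient 1 B y x) = orient 1 B y A := by
    rw [hl]; exact div_mul_cancel₀ _ (by linarith)
  set p : Plane := AffineMap.lineMap A x l with hp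
  have hpo : ∀ U V, orient 1 U V p = (1 - l) * orient 1 U V A + l * orient 1 U V x := fun U V =>
    orient_lineMap 1 U V A x l
  have h₁ : orient 1 A x p = 0 := by rw [hpo]; simp
  have h₂ : orient 1 B y p = 0 := by rw [hpo]; linarith
  have hABp : 0 < orient 1 A B p := by
    rw [hpo, orient_self_outer, mul_zero, zero_add]; exact mul_pos (by linarith) h.insx.ab
  have hCAp : 0 < orient 1 C A p := by
    rw [hpo, orient_self_right, mul_zero, zero_add]; exact mul_pos (by linarith) h.insx.ca
  have hBp : ∀ {u : Plane}, 0 < orient 1 B u y → 0 < orient 1 B u p := by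
    intro u hu
    have e : orient 1 A B y * orient 1 B u p =
        orient 1 A B p * orient 1 B u y + orient 1 A B u * orient 1 B y p := by
      simp only [orient_eq]; ring
    refine pos_of_mul_pos_right (a := orient 1 A B y) ?_ h.insy.ab.le
    rw [e, h₂, mul_zero, add_zero]
    exact mul_pos hABp hu
  have hins : StrictlyInside 1 A B C p := ⟨hABp, hBp h.insy.bc, hCAp⟩
  have hApr : 0 < orient 1 A p r := by
    rw [orient_rotate, orient_rotate, hpo, orient_self_right, mul_zero, zero_add, orient_rotate]
    exact mul_pos (by linarith) h.Axr
  have hxyp : 0 < orient 1 x y p := by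
    have e := orient_swap 1 A y x
    rw [hpo, orient_self_outer, mul_zero, add_zero, ← orient_rotate, e]
    nlinarith [h.Ayx]
  have hex := hexagon_area_pos hins h.insq h.insr hApr (hBp h.Bqy) h.Crq
  have e : orient 1 A x y + orient 1 A y B + orient 1 A B q + orient 1 A q C + orient 1 A C r =
      orient 1 p q r + orient 1 A p r + orient 1 B q p + orient 1 C r q + orient 1 x y p +
        orient 1 A x p - orient 1 B y p := by
    simp only [orient_eq]; ring
  rw [e, h₁, h₂]
  linarith

end HeptagonData

namespace HeptagonData

variable {A B C x y q r m : Plane}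

theorem Bqx (h : HeptagonData A B C x y q r) : 0 < orient 1 B q x :=
  orient_trans h.insq.bc h.insy.bc h.insx.bc h.Bqy h.Byx

theorem Ayr (h : HeptagonData A B C x y q r) : 0 < orient 1 A y r :=
  orient_trans h.insy.ab h.insx.ab h.insr.ab h.Ayx h.Axr

/-- The boundary turns left at `A`, `B`, `C` only. Any two non-adjacent edges are separated by a
line carrying some edge, and all sign conditions follow linearly from the data. -/
theorem isPseudoTriangle (h : HeptagonData A B C x y q r) :
    (⟨![A, x, y, B, q, C, r]⟩ : Polygon Plane 7).IsPseudoTriangle := by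
  have area := h.area_pos
  have hBqx := h.Bqx
  have hAyr := h.Ayr
  obtain ⟨⟨x1, x2, x3⟩, ⟨y1, y2, y3⟩, ⟨q1, q2, q3⟩, ⟨r1, r2, r3⟩, hABC, Ayx, Byx, Axr, Bqy, Crq⟩ := h
  simp only [orient_eq, one_mul] at x1 x2 x3 y1 y2 y3 q1 q2 q3 r1 r2 r3 hABC Ayx Byx Axr Bqy Crq
  simp only [orient_eq, one_mul] at hBqx hAyr area
  have tA : 0 < orient 1 r A x := by rw [orient_eq]; linarith
  have tx : orient 1 A x y < 0 := by rw [orient_eq]; linarith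
  have ty : orient 1 x y B < 0 := by rw [orient_eq]; linarith
  have tB : 0 < orient 1 y B q := by rw [orient_eq]; linarith
  have tq : orient 1 B q C < 0 := by rw [orient_eq]; linarith
  have tC : 0 < orient 1 q C r := by rw [orient_eq]; linarith
  have tr : orient 1 C r A < 0 := by rw [orient_eq]; linarith
  refine ⟨?_, ?_, ?_⟩
  · refine isSimple_heptagon tx.ne ty.ne tB.ne' tq.ne tC.ne' tr.ne tA.ne'
      (disjoint_affineSegment (s := 1) x A ?_ ?_ ?_ ?_)
      (disjoint_affineSegment (s := 1) B y ?_ ?_ ?_ ?_).symm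
      (disjoint_affineSegment (s := 1) B y ?_ ?_ ?_ ?_).symm
      (disjoint_affineSegment (s := 1) A x ?_ ?_ ?_ ?_)
      (disjoint_affineSegment (s := 1) B q ?_ ?_ ?_ ?_).symm
      (disjoint_affineSegment (s := 1) y B ?_ ?_ ?_ ?_)
      (disjoint_affineSegment (s := 1) A x ?_ ?_ ?_ ?_)
      (disjoint_affineSegment (s := 1) r A ?_ ?_ ?_ ?_).symm
      (disjoint_affineSegment (s := 1) y B ?_ ?_ ?_ ?_)
      (disjoint_affineSegment (s := 1) A x ?_ ?_ ?_ ?_)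
      (disjoint_affineSegment (s := 1) r A ?_ ?_ ?_ ?_).symm
      (disjoint_affineSegment (s := 1) C r ?_ ?_ ?_ ?_).symm
      (disjoint_affineSegment (s := 1) C r ?_ ?_ ?_ ?_).symm
      (disjoint_affineSegment (s := 1) q C ?_ ?_ ?_ ?_) <;>
    rw [orient_eq] <;> linarith
  · have e : (⟨![A, x, y, B, q, C, r]⟩ : Polygon Plane 7).signedArea =
        (cross A x + cross x y + cross y B + cross B q + cross q C + cross C r + cross r A) / 2 := by
      rw [Polygon.signedArea, Fin.sum_univ_seven]
      rfl
    rw [Polygon.IsAnticlockwise, e]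
    simp only [cross]
    linarith
  · have hset : {i : Fin 7 | (⟨![A, x, y, B, q, C, r]⟩ : Polygon Plane 7).interiorAngle i < Real.pi} =
        {0, 3, 5} := by
      ext i
      have h0 : ∀ i : Fin 7, ∀ {u v w : Plane},
          (⟨![A, x, y, B, q, C, r]⟩ : Polygon Plane 7).prev i = u →
          (⟨![A, x, y, B, q, C, r]⟩ : Polygon Plane 7) i = v →
          (⟨![A, x, y, B, q, C, r]⟩ : Polygon Plane 7).next i = w → orient 1 u v w ≠ 0 →
          ((⟨![A, x, y, B, q, C, r]⟩ : Polygon Plane 7).interiorAngle i < Real.pi ↔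
            0 < orient 1 u v w) := by
        rintro i _ _ _ rfl rfl rfl h
        exact Polygon.interiorAngle_lt_pi_iff h
      simp only [Set.mem_ofPred_eq, Set.mem_insert_iff, Set.mem_singleton_iff]
      fin_cases i
      · exact (h0 0 rfl rfl rfl tA.ne').trans (iff_of_true tA (by decide))
      · exact (h0 1 rfl rfl rfl tx.ne).trans (iff_of_false tx.not_gt (by decide))
      · exact (h0 2 rfl rfl rfl ty.ne).trans (iff_of_false ty.not_gt (by decide))
      · exact (h0 3 rfl rfl rfl tB.ne').trans (iff_of_true tB (by decide))
      · exact (h0 4 rfl rfl rfl tq.ne).trans (iff_of_false tq.not_gt (by decide))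
      · exact (h0 5 rfl rfl rfl tC.ne').trans (iff_of_true tC (by decide))
      · exact (h0 6 rfl rfl rfl tr.ne).trans (iff_of_false tr.not_gt (by decide))
    rw [hset, Set.ncard_eq_toFinset_card']
    rfl

theorem notMem_inside_of_ray {m O : Plane} (hmO : m ≠ O)
    (h : ∀ t : ℝ, 0 ≤ t → m + t • (m - O) ∉ affineSegment ℝ A x ∧
      m + t • (m - O) ∉ affineSegment ℝ x y ∧ m + t • (m - O) ∉ affineSegment ℝ y B ∧
      m + t • (m - O) ∉ affineSegment ℝ B q ∧ m + t • (m - O) ∉ affineSegment ℝ q C ∧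
      m + t • (m - O) ∉ affineSegment ℝ C r ∧ m + t • (m - O) ∉ affineSegment ℝ r A) :
    m ∉ (⟨![A, x, y, B, q, C, r]⟩ : Polygon Plane 7).inside := by
  refine Polygon.notMem_inside_of_ray (sub_ne_zero.2 hmO) fun t ht hb => ?_
  obtain ⟨i, hi⟩ := Set.mem_iUnion.1 hb
  obtain ⟨h0, h1, h2, h3, h4, h5, h6⟩ := h t ht
  fin_cases i
  exacts [h0 hi, h1 hi, h2 hi, h3 hi, h4 hi, h5 hi, h6 hi]

/-- The ray from `m` away from the opposite corner `C` escapes. Each edge of the heptagon lies,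
together with `C`, on the side of `A x`, `x y` or `B y` not containing `m`. -/
theorem notMem_inside_of_pocket_AB (h : HeptagonData A B C x y q r) (hA : 0 < orient 1 A m x)
    (hB : 0 < orient 1 B y m) (hxy : 0 < orient 1 x m y) :
    m ∉ (⟨![A, x, y, B, q, C, r]⟩ : Polygon Plane 7).inside := by
  have hBqx := h.Bqx
  have hAyr := h.Ayr
  have hxyC : 0 < orient 1 C x y := h.insy.orient_third h.Ayx h.Byx
  obtain ⟨⟨x1, x2, x3⟩, ⟨y1, y2, y3⟩, ⟨q1, q2, q3⟩, ⟨r1, r2, r3⟩, hABC, Ayx, Byx, Axr, Bqy, Crq⟩ := h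
  have hmC : m ≠ C := by
    rintro rfl
    exact orient_asymm hA (by rw [← orient_rotate]; exact x3)
  simp only [orient_eq, one_mul] at x1 x2 x3 y1 y2 y3 q1 q2 q3 r1 r2 r3 hABC Ayx Byx Axr Bqy Crq
  simp only [orient_eq, one_mul] at hBqx hAyr hA hB hxy hxyC
  refine notMem_inside_of_ray hmC fun t ht =>
    ⟨ray_notMem_affineSegment (s := 1) x A ?_ ?_ ?_ ?_ ht,
      ray_notMem_affineSegment (s := 1) y x ?_ ?_ ?_ ?_ ht,
      ray_notMem_affineSegment (s := 1) B y ?_ ?_ ?_ ?_ ht,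
      ray_notMem_affineSegment (s := 1) B y ?_ ?_ ?_ ?_ ht,
      ray_notMem_affineSegment (s := 1) B y ?_ ?_ ?_ ?_ ht,
      ray_notMem_affineSegment (s := 1) x A ?_ ?_ ?_ ?_ ht,
      ray_notMem_affineSegment (s := 1) x A ?_ ?_ ?_ ?_ ht⟩ <;>
  rw [orient_eq] <;> linarith

/-- The escaping ray leads away from `A`, and the lines `B q` and `C q` shield it from the edges. -/
theorem notMem_inside_of_pocket_BC (h : HeptagonData A B C x y q r) (hB : 0 < orient 1 B m q)
    (hC : 0 < orient 1 C q m) : m ∉ (⟨![A, x, y, B, q, C, r]⟩ : Polygon Plane 7).inside := by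
  have hBqx := h.Bqx
  have hAyr := h.Ayr
  obtain ⟨⟨x1, x2, x3⟩, ⟨y1, y2, y3⟩, ⟨q1, q2, q3⟩, ⟨r1, r2, r3⟩, hABC, Ayx, Byx, Axr, Bqy, Crq⟩ := h
  have hmA : m ≠ A := by
    rintro rfl
    exact orient_asymm hB (by rw [← orient_rotate]; exact q1)
  simp only [orient_eq, one_mul] at x1 x2 x3 y1 y2 y3 q1 q2 q3 r1 r2 r3 hABC Ayx Byx Axr Bqy Crq
  simp only [orient_eq, one_mul] at hBqx hAyr hB hC
  refine notMem_inside_of_ray hmA fun t ht =>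
    ⟨ray_notMem_affineSegment (s := 1) q B ?_ ?_ ?_ ?_ ht,
      ray_notMem_affineSegment (s := 1) q B ?_ ?_ ?_ ?_ ht,
      ray_notMem_affineSegment (s := 1) q B ?_ ?_ ?_ ?_ ht,
      ray_notMem_affineSegment (s := 1) q B ?_ ?_ ?_ ?_ ht,
      ray_notMem_affineSegment (s := 1) C q ?_ ?_ ?_ ?_ ht,
      ray_notMem_affineSegment (s := 1) C q ?_ ?_ ?_ ?_ ht,
      ray_notMem_affineSegment (s := 1) C q ?_ ?_ ?_ ?_ ht⟩ <;>
  rw [orient_eq] <;> linarith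

theorem notMem_inside_of_pocket_CA (h : HeptagonData A B C x y q r) (hC : 0 < orient 1 C m r)
    (hA : 0 < orient 1 A r m) : m ∉ (⟨![A, x, y, B, q, C, r]⟩ : Polygon Plane 7).inside := by
  have hBqx := h.Bqx
  have hAyr := h.Ayr
  obtain ⟨⟨x1, x2, x3⟩, ⟨y1, y2, y3⟩, ⟨q1, q2, q3⟩, ⟨r1, r2, r3⟩, hABC, Ayx, Byx, Axr, Bqy, Crq⟩ := h
  have hmB : m ≠ B := by
    rintro rfl
    exact orient_asymm hC (by rw [← orient_rotate]; exact r2)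
  simp only [orient_eq, one_mul] at x1 x2 x3 y1 y2 y3 q1 q2 q3 r1 r2 r3 hABC Ayx Byx Axr Bqy Crq
  simp only [orient_eq, one_mul] at hBqx hAyr hA hC
  refine notMem_inside_of_ray hmB fun t ht =>
    ⟨ray_notMem_affineSegment (s := 1) A r ?_ ?_ ?_ ?_ ht,
      ray_notMem_affineSegment (s := 1) A r ?_ ?_ ?_ ?_ ht,
      ray_notMem_affineSegment (s := 1) A r ?_ ?_ ?_ ?_ ht,
      ray_notMem_affineSegment (s := 1) r C ?_ ?_ ?_ ?_ ht,
      ray_notMem_affineSegment (s := 1) r C ?_ ?_ ?_ ?_ ht,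
      ray_notMem_affineSegment (s := 1) r C ?_ ?_ ?_ ?_ ht,
      ray_notMem_affineSegment (s := 1) A r ?_ ?_ ?_ ?_ ht⟩ <;>
  rw [orient_eq] <;> linarith

/-- A point beyond an edge line of the triangle `A B C` is not inside the heptagon. -/
theorem notMem_inside_of_outside (h : HeptagonData A B C x y q r)
    (hm : orient 1 A B m < 0 ∨ orient 1 B C m < 0 ∨ orient 1 C A m < 0) :
    m ∉ (⟨![A, x, y, B, q, C, r]⟩ : Polygon Plane 7).inside := by
  obtain ⟨⟨x1, x2, x3⟩, ⟨y1, y2, y3⟩, ⟨q1, q2, q3⟩, ⟨r1, r2, r3⟩, hABC, -, -, -, -, -⟩ := h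
  have key : ∀ U V O : Plane, orient 1 U V m < 0 → (∀ P ∈ ({A, x, y, B, q, C, r, O} : Set Plane),
      0 ≤ orient 1 U V P) → m ∉ (⟨![A, x, y, B, q, C, r]⟩ : Polygon Plane 7).inside := by
    intro U V O hm hP
    have hP' : ∀ P ∈ ({A, x, y, B, q, C, r, O} : Set Plane), orient 1 V U P ≤ 0 := by
      intro P hP''
      have := hP P hP''
      rw [← orient_rotate, orient_swap]
      rw [orient_rotate, orient_rotate] at this
      linarith
    have hm' : 0 < orient 1 V U m := by
      rw [orient_rotate, orient_rotate] at hm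
      rw [← orient_rotate, orient_swap]; linarith
    have hmO : m ≠ O := by
      rintro rfl
      exact (hP' m (by simp)).not_gt hm'
    refine notMem_inside_of_ray hmO fun t ht => ⟨?_, ?_, ?_, ?_, ?_, ?_, ?_⟩ <;>
    exact ray_notMem_affineSegment (s := 1) V U hm' (hP' _ (by simp)) (hP' _ (by simp))
      (hP' _ (by simp)) ht
  simp only [orient_eq, one_mul] at x1 x2 x3 y1 y2 y3 q1 q2 q3 r1 r2 r3 hABC
  rcases hm with hm | hm | hm
  · refine key A B C hm ?_
    rintro P (rfl | rfl | rfl | rfl | rfl | rfl | rfl | rfl) <;> rw [orient_eq] <;> linarith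
  · refine key B C A hm ?_
    rintro P (rfl | rfl | rfl | rfl | rfl | rfl | rfl | rfl) <;> rw [orient_eq] <;> linarith
  · refine key C A B hm ?_
    rintro P (rfl | rfl | rfl | rfl | rfl | rfl | rfl | rfl) <;> rw [orient_eq] <;> linarith

end HeptagonData

/-! ### Emptiness of the heptagon for two triangular pockets and a quadrilateral one. -/

namespace Pockets

variable {S : Set Plane} {s : ℝ} {A B C x y q r : Plane} {X Y Z : Set Plane}

/-- Every point of `S` that is not a vertex of the heptagon lies in one of the removed hulls or
strictly beyond an edge line of the triangle; either way a ray leads from it to infinity. -/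
theorem contains_of_below_one (h : Pockets S 1 A B C X Y Z) (hS : NoThreeAligned S)
    (hx : x ∈ X) (hy : y ∈ X) (hxy : x ≠ y)
    (hlast : ∀ m ∈ X, m ≠ x → 0 < orient 1 A m x)
    (hfirst : ∀ m ∈ X, m ≠ y → 0 < orient 1 B y m)
    (hbelow : ∀ m ∈ X, m ≠ x → m ≠ y → 0 < orient 1 x m y)
    (hq : IsApex 1 B C Y q) (hr : IsApex 1 C A Z r) : ContainsEmptyPseudoTriangle S 7 := by
  have hd : HeptagonData A B C x y q r :=
    ⟨h.insX x hx, h.insX y hy, h.insY q hq.1, h.insZ r hr.1, h.pos, hlast y hy hxy.symm,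
      hfirst x hx hxy, h.sepA x hx r hr.1, h.sepB q hq.1 y hy, h.sepC r hr.1 q hq.1⟩
  have hv : ∀ i, (⟨![A, x, y, B, q, C, r]⟩ : Polygon Plane 7) i ∈ S := by
    intro i
    fin_cases i
    exacts [h.memA, h.subX hx, h.subX hy, h.memB, h.subY hq.1, h.memC, h.subZ hr.1]
  refine ⟨⟨![A, x, y, B, q, C, r]⟩, hd.isPseudoTriangle, Set.range_subset_iff.2 hv,
    Set.disjoint_right.2 fun m hm => ?_⟩
  by_cases hrange : m ∈ Set.range (⟨![A, x, y, B, q, C, r]⟩ : Polygon Plane 7).vertices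
  · exact Polygon.notMem_inside_of_mem_range hrange
  have hne : ∀ i, (⟨![A, x, y, B, q, C, r]⟩ : Polygon Plane 7) i ≠ m := fun i hi => hrange ⟨i, hi⟩
  have hmA : A ≠ m := hne 0
  have hmx : x ≠ m := hne 1
  have hmy : y ≠ m := hne 2
  have hmB : B ≠ m := hne 3
  have hmq : q ≠ m := hne 4
  have hmC : C ≠ m := hne 5
  have hmr : r ≠ m := hne 6
  have hAB : A ≠ B := by rintro rfl; simpa using h.pos
  have hBC : B ≠ C := by rintro rfl; simpa using h.pos
  have hCA : C ≠ A := by rintro rfl; simpa using h.pos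
  by_cases hin : StrictlyInside 1 A B C m
  · rcases h.cover m hm hin with hmX | hmY | hmZ
    · exact hd.notMem_inside_of_pocket_AB (hlast m hmX hmx.symm) (hfirst m hmX hmy.symm)
        (hbelow m hmX hmx.symm hmy.symm)
    · exact hd.notMem_inside_of_pocket_BC (hq.2 m hmY hmq.symm).1 (hq.2 m hmY hmq.symm).2
    · exact hd.notMem_inside_of_pocket_CA (hr.2 m hmZ hmr.symm).1 (hr.2 m hmZ hmr.symm).2
  · refine hd.notMem_inside_of_outside ?_
    by_contra hcon
    push Not at hcon
    exact hin ⟨lt_of_le_of_ne hcon.1 (hS A h.memA B h.memB m hm hAB hmA hmB).symm,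
      lt_of_le_of_ne hcon.2.1 (hS B h.memB C h.memC m hm hBC hmB hmC).symm,
      lt_of_le_of_ne hcon.2.2 (hS C h.memC A h.memA m hm hCA hmC hmA).symm⟩

theorem orient_pos_rescale {u v w : Plane} (hs : 0 < s) : 0 < orient s u v w ↔ 0 < orient 1 u v w := by
  rw [orient_eq, orient_eq, one_mul, mul_pos_iff_of_pos_left hs]

/-- Everything depends on the sign of `s` only. -/
theorem normalize (h : Pockets S s A B C X Y Z) (hs : 0 < s) : Pockets S 1 A B C X Y Z := by
  have hi : ∀ m, StrictlyInside s A B C m ↔ StrictlyInside 1 A B C m := fun m =>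
    ⟨fun ⟨h₁, h₂, h₃⟩ => ⟨(orient_pos_rescale hs).1 h₁, (orient_pos_rescale hs).1 h₂,
      (orient_pos_rescale hs).1 h₃⟩, fun ⟨h₁, h₂, h₃⟩ => ⟨(orient_pos_rescale hs).2 h₁,
      (orient_pos_rescale hs).2 h₂, (orient_pos_rescale hs).2 h₃⟩⟩
  obtain ⟨-, hA, hB, hC, hpos, sX, sY, sZ, iX, iY, iZ, cov, pA, pB, pC⟩ := h
  simp only [hi, orient_pos_rescale hs] at *
  exact ⟨one_ne_zero, hA, hB, hC, hpos, sX, sY, sZ, iX, iY, iZ, cov, pA, pB, pC⟩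

/-- The pockets over `B C` and `C A` are triangles, the pocket over `A B` is a quadrilateral. -/
theorem contains_of_below (h : Pockets S s A B C X Y Z) (hS : NoThreeAligned S)
    (hx : x ∈ X) (hy : y ∈ X) (hxy : x ≠ y)
    (hlast : ∀ m ∈ X, m ≠ x → 0 < orient s A m x)
    (hfirst : ∀ m ∈ X, m ≠ y → 0 < orient s B y m)
    (hbelow : ∀ m ∈ X, m ≠ x → m ≠ y → 0 < orient s x m y)
    (hq : IsApex s B C Y q) (hr : IsApex s C A Z r) : ContainsEmptyPseudoTriangle S 7 := by
  have pos : ∀ {s : ℝ} {A B : Plane} {Y Z : Set Plane} {x y q r : Plane}, 0 < s →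
      Pockets S s A B C X Y Z → x ∈ X → y ∈ X → x ≠ y →
      (∀ m ∈ X, m ≠ x → 0 < orient s A m x) → (∀ m ∈ X, m ≠ y → 0 < orient s B y m) →
      (∀ m ∈ X, m ≠ x → m ≠ y → 0 < orient s x m y) → IsApex s B C Y q → IsApex s C A Z r →
      ContainsEmptyPseudoTriangle S 7 := by
    intro s A B Y Z x y q r hs h hx hy hxy hlast hfirst hbelow hq hr
    have hp := h.normalize hs
    simp only [IsApex, orient_pos_rescale hs] at hlast hfirst hbelow hq hr
    exact hp.contains_of_below_one hS hx hy hxy hlast hfirst hbelow hq hr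
  -- For negative `s` the triangle is clockwise, and exchanging `A` and `B` makes it anti-clockwise.
  rcases h.s_ne.lt_or_gt with hs | hs
  · refine pos (neg_pos.2 hs) h.mirror hy hx hxy.symm ?_ ?_ ?_ hr.mirror hq.mirror
    · intro m hm hmy; rw [orient_neg]; exact hfirst m hm hmy
    · intro m hm hmx; rw [orient_neg]; exact hlast m hm hmx
    · intro m hm hmy hmx; rw [orient_neg, orient_rotate]; exact hbelow m hm hmx hmy
  · exact pos hs h hx hy hxy hlast hfirst hbelow hq hr

end Pockets

/-! ### Reduction of arbitrary pockets to the quadrilateral case. -/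

namespace Pockets

variable {S : Set Plane} {s : ℝ} {A B C t u v x y z q r w : Plane} {X Y Z : Set Plane}

/-- The pockets over `B C` and `C A` are triangles, the pocket over `A B` is not. -/
theorem contains_of_not_hasApex (hS : NoThreeAligned S) (hfin : S.Finite)
    (h : Pockets S s A B C X Y Z) (hne : X.Nonempty) (hX : ¬ HasApex s A B X)
    (hY : HasApex s B C Y) (hZ : HasApex s C A Z) : ContainsEmptyPseudoTriangle S 7 := by
  induction hn : X.ncard using Nat.strong_induction_on generalizing s A B C X Y Z with
  | _ n ih =>
  subst hn
  obtain ⟨q, hq⟩ := hY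
  obtain ⟨r, hr⟩ := hZ
  have hXfin := hfin.subset h.subX
  -- the case where the triangle can be cut down at `x`, up to mirroring
  have key : ∀ {s : ℝ} {A B C : Plane} {Y Z : Set Plane} {x y q r m : Plane},
      Pockets S s A B C X Y Z → IsApex s B C Y q → IsApex s C A Z r → x ∈ X → y ∈ X → m ∈ X →
      (∀ m ∈ X, m ≠ x → 0 < orient s A m x) → (∀ m ∈ X, m ≠ y → 0 < orient s B y m) → x ≠ y →
      0 < orient s x y m → 0 < orient s C x r → ContainsEmptyPseudoTriangle S 7 := by
    intro s A B C Y Z x y q r m h hq hr hx hy hm hlast hfirst hxy hxym hxr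
    refine ih _ ?_ (h.cut hx hlast hr hxr) ⟨y, hy, hfirst x hx hxy⟩
      (h.not_hasApex_cut hx hy hm hlast hfirst hxy hxym) ⟨q, hq⟩ ⟨r, h.isApex_cut hx hr hxr⟩ rfl
    refine Set.ncard_lt_ncard ⟨Set.sep_subset _ _, fun hsub => ?_⟩ hXfin
    simpa using (hsub hx).2
  obtain ⟨x, hx, y, hy, hxy, hlast, hfirst⟩ := h.exists_last_first hS hfin hne hX
  -- If nothing lies beyond the line `x y`, the hull over `A B` is the quadrilateral `A B y x`.
  -- Otherwise a point `m` beyond it is what keeps the shrunken pocket from being a triangle.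
  by_cases hb : ∀ m ∈ X, m ≠ x → m ≠ y → 0 < orient s x m y
  · exact h.contains_of_below hS hx hy hxy hlast hfirst hb hq hr
  push Not at hb
  obtain ⟨m, hm, hmx, hmy, hle⟩ := hb
  have hxym : 0 < orient s x y m :=
    (orient_total hS h.s_ne (h.subX hx) (h.subX hy) (h.subX hm) hxy hmx.symm hmy.symm).resolve_right
      hle.not_gt
  have hxr : x ≠ r := ne_of_orient_pos (h.sepA x hx r hr.1)
  have hyq : q ≠ y := ne_of_orient_pos (h.sepB q hq.1 y hy)
  rcases orient_total hS h.s_ne h.memC (h.subX hx) (h.subZ hr.1) (ne_C (h.insX x hx)).symm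
    (ne_C (h.insZ r hr.1)).symm hxr with hC | hrx
  · exact key h hq hr hx hy hm hlast hfirst hxy hxym hC
  rcases orient_total hS h.s_ne h.memC (h.subY hq.1) (h.subX hy) (ne_C (h.insY q hq.1)).symm
    (ne_C (h.insX y hy)).symm hyq with hC | hqy
  · refine key h.mirror hr.mirror hq.mirror hy hx hm ?_ ?_ hxy.symm ?_ ?_
    · intro m hm hmy; rw [orient_neg]; exact hfirst m hm hmy
    · intro m hm hmx; rw [orient_neg]; exact hlast m hm hmx
    · rw [orient_neg, ← orient_rotate]; exact hxym
    · rw [orient_neg]; exact hC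
  -- Here `C` sees `r` before `x`, and `x` before `y` before `q`. So `x` comes before all of `Y` and
  -- can join `Z` as its apex.
  · have hAyx := hlast y hy hxy.symm
    have hByx := hfirst x hx hxy
    have hxq : 0 < orient s C x q := trans_C (h.insX x hx) (h.insX y hy) (h.insY q hq.1)
      ((h.insX y hy).orient_third hAyx hByx) hqy
    have hxY : ∀ y ∈ Y, 0 < orient s C x y := by
      intro b hb
      by_cases hbq : b = q
      · rwa [hbq]
      · exact trans_C (h.insX x hx) (h.insY q hq.1) (h.insY b hb) hxq (hq.2 b hb hbq).2
    refine ih _ ?_ (h.move hx hlast hxY) ⟨y, hy, hxy.symm⟩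
      (h.not_hasApex_sdiff hy hm hfirst hAyx hByx hxym) ⟨q, hq⟩ ⟨x, h.isApex_insert hx hr hrx⟩ rfl
    exact Set.ncard_sdiff_singleton_lt_of_mem hx hXfin

/-- The pocket over `C A` is a triangle, the pocket over `B C` is not. -/
theorem contains_of_not_hasApex_of_nonempty (hS : NoThreeAligned S) (hfin : S.Finite)
    (h : Pockets S s A B C X Y Z) (hne : X.Nonempty) (hYne : Y.Nonempty)
    (hY : ¬ HasApex s B C Y) (hZ : HasApex s C A Z) : ContainsEmptyPseudoTriangle S 7 := by
  induction hn : X.ncard using Nat.strong_induction_on generalizing s A B C X Y Z with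
  | _ n ih =>
  subst hn
  -- If `X` has an apex, `Y` is the only pocket without one, and a rotation puts it in first place.
  by_cases hX : HasApex s A B X
  · exact contains_of_not_hasApex hS hfin h.rotate hYne hY hZ hX
  obtain ⟨r, hr⟩ := hZ
  have hXfin := hfin.subset h.subX
  obtain ⟨x, hx, y, hy, hxy, hlast, hfirst⟩ := h.exists_last_first hS hfin hne hX
  have hAyx := hlast y hy hxy.symm
  have hByx := hfirst x hx hxy
  have hCxy := (h.insX y hy).orient_third hAyx hByx
  obtain ⟨z, hz, hzfirst⟩ := exists_first hS h.s_ne h.memC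
    (by rw [← orient_rotate]; exact h.pos) h.subY (fun m hm => (h.insY m hm).rotate)
    (hfin.subset h.subY) hYne
  have hxr : x ≠ r := ne_of_orient_pos (h.sepA x hx r hr.1)
  have hzx : z ≠ x := ne_of_orient_pos (h.sepB z hz x hx)
  have hix := h.insX x hx
  have hiz := h.insY z hz
  rcases orient_total hS h.s_ne h.memC (h.subY hz) (h.subX hx) (ne_C hiz).symm (ne_C hix).symm hzx
    with hCzx | hCxz
  -- Give `y` to `Y`. As the last point from `B` it excludes every other apex, and it is none itself
  -- because `C` sees `z` before it.
  · have hCzy : 0 < orient s C z y := trans_C hiz hix (h.insX y hy) hCzx hCxy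
    refine ih _ ?_ (h.move' hy hfirst fun b hb => trans_C (h.insZ b hb) hiz (h.insX y hy)
      (h.sepC b hb z hz) hCzy) ⟨x, hx, hxy⟩ ⟨y, Set.mem_insert _ _⟩ ?_ ⟨r, hr⟩ rfl
    · exact Set.ncard_sdiff_singleton_lt_of_mem hy hXfin
    · rintro ⟨t, ht, htop⟩
      by_cases hty : t = y
      · subst hty
        exact orient_asymm (htop z (Set.mem_insert_of_mem _ hz) (ne_of_orient_pos hCzy)).2 hCzy
      · exact orient_asymm (htop y (Set.mem_insert _ _) (Ne.symm hty)).1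
          (h.sepB t (ht.resolve_left hty) y hy)
  rcases orient_total hS h.s_ne h.memC (h.subX hx) (h.subZ hr.1) (ne_C hix).symm
    (ne_C (h.insZ r hr.1)).symm hxr with hCxr | hCrx
  · refine ih _ ?_ (h.cut hx hlast hr hCxr) ⟨y, hy, hByx⟩ hYne hY ⟨r, h.isApex_cut hx hr hCxr⟩ rfl
    refine Set.ncard_lt_ncard ⟨Set.sep_subset _ _, fun hsub => ?_⟩ hXfin
    simpa using (hsub hx).2
  -- Now `x` is behind `r` but before all of `Y` as seen from `C`, so it joins `Z` as the new apex.
  · refine ih _ ?_ (h.move hx hlast ?_) ⟨y, hy, hxy.symm⟩ hYne hY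
      ⟨x, h.isApex_insert hx hr hCrx⟩ rfl
    · exact Set.ncard_sdiff_singleton_lt_of_mem hx hXfin
    · intro b hb
      by_cases hbz : b = z
      · rwa [hbz]
      · exact trans_C hix hiz (h.insY b hb) hCxz (hzfirst b hb hbz)

/-- Handing `t` to `Y` destroys any apex there: `t` is last from `B`, so no other point qualifies,
and `z` before `t` from `C` disqualifies `t`. -/
theorem contains_of_isApex (hS : NoThreeAligned S) (hfin : S.Finite)
    (h : Pockets S s A B C X Y Z) (ht : IsApex s A B X t) (hne : (X \ {t}).Nonempty) (hz : z ∈ Y)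
    (hzt : 0 < orient s C z t) (hZ : HasApex s C A Z) : ContainsEmptyPseudoTriangle S 7 := by
  have hit := h.insX t ht.1
  have hiz := h.insY z hz
  refine contains_of_not_hasApex_of_nonempty hS hfin (h.move' ht.1 (fun m hm hmt => (ht.2 m hm hmt).2)
    fun b hb => trans_C (h.insZ b hb) hiz hit (h.sepC b hb z hz) hzt) hne ⟨t, Set.mem_insert _ _⟩
    ?_ hZ
  rintro ⟨t', ht', htop⟩
  by_cases htt : t' = t
  · subst htt
    exact orient_asymm (htop z (Set.mem_insert_of_mem _ hz) (ne_of_orient_pos hzt)).2 hzt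
  · exact orient_asymm (htop t (Set.mem_insert _ _) (Ne.symm htt)).1
      (h.sepB t' (ht'.resolve_left htt) t ht.1)

/-- The start of the argument: only one point in each of the pockets over `B C` and `C A`. -/
theorem contains_of_singletons (hS : NoThreeAligned S) (hfin : S.Finite)
    (h : Pockets S s A B C X {z} {v}) (hcard : 3 ≤ X.ncard) : ContainsEmptyPseudoTriangle S 7 := by
  have hXfin := hfin.subset h.subX
  have hne : X.Nonempty := Set.nonempty_of_ncard_ne_zero (by omega)
  by_cases hX : HasApex s A B X
  swap
  · exact contains_of_not_hasApex hS hfin h hne hX (hasApex_singleton ..) (hasApex_singleton ..)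
  obtain ⟨t, ht⟩ := hX
  have hc : (X \ {t}).ncard + 1 = X.ncard := Set.ncard_sdiff_singleton_add_one ht.1 hXfin
  have hne' : (X \ {t}).Nonempty := Set.nonempty_of_ncard_ne_zero (by omega)
  have hit := h.insX t ht.1
  have hiz := h.insY z rfl
  have hiv := h.insZ v rfl
  have hzt : z ≠ t := ne_of_orient_pos (h.sepB z rfl t ht.1)
  have htv : t ≠ v := ne_of_orient_pos (h.sepA t ht.1 v rfl)
  have htlast : ∀ m ∈ X, m ≠ t → 0 < orient s A m t := fun m hm hmt => (ht.2 m hm hmt).1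
  have htfirst : ∀ m ∈ X, m ≠ t → 0 < orient s B t m := fun m hm hmt => (ht.2 m hm hmt).2
  rcases orient_total hS h.s_ne h.memC (h.subY rfl) (h.subX ht.1) (ne_C hiz).symm (ne_C hit).symm hzt
    with hCzt | hCtz
  · exact contains_of_isApex hS hfin h ht hne' rfl hCzt (hasApex_singleton ..)
  rcases orient_total hS h.s_ne h.memC (h.subX ht.1) (h.subZ rfl) (ne_C hit).symm (ne_C hiv).symm htv
    with hCtv | hCvt
  · exact contains_of_isApex hS hfin h.mirror ht.mirror hne' rfl (by rwa [orient_neg])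
      (hasApex_singleton ..)
  -- Seen from `C`, the apex `t` lies between `v` and `z`, so it can join either of the other
  -- pockets. Should `X` still have an apex `w` afterwards, the order of `t` and `w` around `C`
  -- decides which choice to use.
  have h₁ : Pockets S s A B C (X \ {t}) {t, z} {v} :=
    h.move' ht.1 htfirst (by rintro _ rfl; exact hCvt)
  have h₂ : Pockets S s A B C (X \ {t}) {z} {t, v} :=
    h.move ht.1 htlast (by rintro _ rfl; exact hCtz)
  by_cases hX' : HasApex s A B (X \ {t})
  swap
  · refine contains_of_not_hasApex hS hfin h₁ hne' hX' ⟨t, by simp, ?_⟩ (hasApex_singleton ..)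
    rintro m (rfl | rfl) hmt
    · exact absurd rfl hmt
    · exact ⟨h.sepB _ rfl t ht.1, hCtz⟩
  obtain ⟨w, hw⟩ := hX'
  have hc' : ((X \ {t}) \ {w}).ncard + 1 = (X \ {t}).ncard :=
    Set.ncard_sdiff_singleton_add_one hw.1 (hXfin.subset Set.sdiff_subset)
  have hne'' : ((X \ {t}) \ {w}).Nonempty := Set.nonempty_of_ncard_ne_zero (by omega)
  have hwt : t ≠ w := fun e => hw.1.2 e.symm
  rcases orient_total hS h.s_ne h.memC (h.subX ht.1) (h.subX hw.1.1) (ne_C hit).symm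
    (ne_C (h.insX w hw.1.1)).symm hwt with hCtw | hCwt
  · exact contains_of_isApex hS hfin h₁ hw hne'' (Set.mem_insert t _) hCtw (hasApex_singleton ..)
  · exact contains_of_isApex hS hfin h₂.mirror hw.mirror hne'' (Set.mem_insert t _)
      (by rwa [orient_neg]) (hasApex_singleton ..)

end Pockets

/-- A triangle with at least five points of `S` inside. -/
theorem contains_of_five_le {S : Set Plane} {s : ℝ} {A B C : Plane} (hS : NoThreeAligned S)
    (hfin : S.Finite) (hs : s ≠ 0) (hA : A ∈ S) (hB : B ∈ S) (hC : C ∈ S)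
    (hpos : 0 < orient s A B C) (hcard : 5 ≤ {m ∈ S | StrictlyInside s A B C m}.ncard) :
    ContainsEmptyPseudoTriangle S 7 := by
  set I := {m ∈ S | StrictlyInside s A B C m} with hI
  have hIfin : I.Finite := hfin.subset (Set.sep_subset _ _)
  have main : ∀ z ∈ I, ∀ v ∈ I, 0 < orient s C v z →
      (∀ m ∈ I, m ≠ z → m ≠ v → 0 < orient s B z m ∧ 0 < orient s A m v) →
      ContainsEmptyPseudoTriangle S 7 := by
    intro z hz v hv hCvz hsep
    have hvz : v ≠ z := ne_of_orient_pos hCvz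
    have h : Pockets S s A B C ((I \ {z}) \ {v}) {z} {v} :=
      { s_ne := hs, memA := hA, memB := hB, memC := hC, pos := hpos
        subX := fun m hm => hm.1.1.1
        subY := by rintro _ rfl; exact hz.1
        subZ := by rintro _ rfl; exact hv.1
        insX := fun m hm => hm.1.1.2
        insY := by rintro _ rfl; exact hz.2
        insZ := by rintro _ rfl; exact hv.2
        cover := by
          intro m hm hi
          by_cases h₁ : m = z
          · simp [h₁]
          by_cases h₂ : m = v
          · simp [h₂]
          exact Or.inl ⟨⟨⟨hm, hi⟩, h₁⟩, h₂⟩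
        sepA := by rintro m hm _ rfl; exact (hsep m hm.1.1 hm.1.2 hm.2).2
        sepB := by rintro _ rfl m hm; exact (hsep m hm.1.1 hm.1.2 hm.2).1
        sepC := by rintro _ rfl _ rfl; exact hCvz }
    refine Pockets.contains_of_singletons hS hfin h ?_
    have h₁ := Set.ncard_sdiff_singleton_add_one hz hIfin
    have h₂ := Set.ncard_sdiff_singleton_add_one (s := I \ {z}) (a := v) ⟨hv, hvz⟩
      (hIfin.subset Set.sdiff_subset)
    omega
  have last : ∀ J ⊆ I, J.Nonempty → ∃ x ∈ J, ∀ m ∈ J, m ≠ x → 0 < orient s A m x := fun J hJ hne =>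
    Pockets.exists_last hS hs hA hpos (fun m hm => (hJ hm).1) (fun m hm => (hJ hm).2)
      (hIfin.subset hJ) hne
  have first : ∀ J ⊆ I, J.Nonempty → ∃ y ∈ J, ∀ m ∈ J, m ≠ y → 0 < orient s B y m :=
    fun J hJ hne => Pockets.exists_first hS hs hB hpos (fun m hm => (hJ hm).1)
      (fun m hm => (hJ hm).2) (hIfin.subset hJ) hne
  have hIne : I.Nonempty := Set.nonempty_of_ncard_ne_zero (by omega)
  obtain ⟨v, hv, hvlast⟩ := last I subset_rfl hIne
  obtain ⟨z, hz, hzfirst⟩ := first I subset_rfl hIne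
  by_cases hvz : v = z
  swap
  · exact main z hz v hv (hz.2.orient_third (hvlast z hz (Ne.symm hvz)) (hzfirst v hv hvz))
      fun m hm h₁ h₂ => ⟨hzfirst m hm h₁, hvlast m hm h₂⟩
  subst hvz
  have hc := Set.ncard_sdiff_singleton_add_one hz hIfin
  have hJ : I \ {v} ⊆ I := Set.sdiff_subset
  have hJne : (I \ {v}).Nonempty := Set.nonempty_of_ncard_ne_zero (by omega)
  obtain ⟨v', hv', hvlast'⟩ := last _ hJ hJne
  obtain ⟨z', hz', hzfirst'⟩ := first _ hJ hJne
  -- One point is extreme from both `A` and `B`. Its position relative to the runner-up `v'`, seen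
  -- from `C`, decides whether it goes to the pocket over `C A` or over `B C`.
  rcases Pockets.orient_total hS hs hC hv.1 hv'.1.1 (Pockets.ne_C hv.2).symm
    (Pockets.ne_C hv'.1.2).symm (Ne.symm hv'.2) with h₁ | h₁
  · refine main z' hz'.1 v hv ?_ fun m hm h₂ h₃ => ⟨hzfirst' m ⟨hm, h₃⟩ h₂, hvlast m hm h₃⟩
    by_cases hvz' : v' = z'
    · rwa [← hvz']
    · exact Pockets.trans_C hv.2 hv'.1.2 hz'.1.2 h₁
        (hz'.1.2.orient_third (hvlast' z' hz' (Ne.symm hvz')) (hzfirst' v' hv' hvz'))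
  · exact main v hv v' hv'.1 h₁ fun m hm h₂ h₃ => ⟨hzfirst m hm h₂, hvlast' m ⟨hm, h₂⟩ h₃⟩

/-! ### From convex hulls and collinearity to orientations. -/

section Hull

variable {s : ℝ} {A B C P Q m : Plane} {S : Set Plane}

theorem orient_eq_zero_of_collinear (h : Collinear ℝ {A, B, C}) : orient s A B C = 0 := by
  obtain ⟨v, hv⟩ := (collinear_iff_of_mem (p₀ := A) (by simp)).1 h
  obtain ⟨b, rfl⟩ := hv B (by simp)
  obtain ⟨c, rfl⟩ := hv C (by simp)
  simp only [orient_eq, vadd_eq_add, PiLp.add_apply, PiLp.smul_apply, smul_eq_mul]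
  ring

theorem collinear_of_orient_eq_zero (h : orient 1 A B C = 0) : Collinear ℝ {A, B, C} := by
  rw [orient_eq, one_mul] at h
  rcases eq_or_ne B A with rfl | hBA
  · simpa using collinear_pair ℝ B C
  refine (collinear_iff_of_mem (p₀ := A) (by simp)).2 ⟨B - A, ?_⟩
  have hC : ∃ r : ℝ, C = r • (B - A) +ᵥ A := by
    by_cases h₀ : B 0 - A 0 = 0
    · have h₁ : B 1 - A 1 ≠ 0 := fun h₁ => hBA <| by
        ext i; fin_cases i
        exacts [sub_eq_zero.1 h₀, sub_eq_zero.1 h₁]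
      have h₂ : C 0 - A 0 = 0 := by
        rw [h₀, zero_mul, zero_sub, neg_eq_zero] at h
        exact (mul_eq_zero.1 h).resolve_left h₁
      refine ⟨(C 1 - A 1) / (B 1 - A 1), ?_⟩
      ext i; fin_cases i
      · simp [h₀]; linarith
      · simp [h₁]
    · refine ⟨(C 0 - A 0) / (B 0 - A 0), ?_⟩
      ext i; fin_cases i
      · simp [h₀]
      · simp only [Fin.mk_one, vadd_eq_add, PiLp.add_apply, PiLp.smul_apply, PiLp.sub_apply,
          smul_eq_mul]
        field_simp
        linarith
  rintro p (rfl | rfl | rfl)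
  · exact ⟨0, by simp⟩
  · exact ⟨1, by simp⟩
  · exact hC

theorem InGeneralPosition.noThreeAligned (h : InGeneralPosition S) : NoThreeAligned S :=
  fun a ha b hb c hc hab hac hbc h₀ => h a ha b hb c hc hab hac hbc (collinear_of_orient_eq_zero h₀)

theorem NoThreeAligned.inGeneralPosition (h : NoThreeAligned S) : InGeneralPosition S :=
  fun a ha b hb c hc hab hac hbc h₀ => h a ha b hb c hc hab hac hbc (orient_eq_zero_of_collinear h₀)

theorem convex_orient_nonneg (s : ℝ) (P Q : Plane) : Convex ℝ {m | 0 ≤ orient s P Q m} := by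
  refine convex_iff_add_mem.2 fun x hx y hy a b ha hb hab => ?_
  have e : orient s P Q (a • x + b • y) = a * orient s P Q x + b * orient s P Q y := by
    obtain rfl : b = 1 - a := by linarith
    simp only [orient_eq, PiLp.add_apply, PiLp.smul_apply, smul_eq_mul]
    ring
  rw [Set.mem_ofPred_eq, e]
  exact add_nonneg (mul_nonneg ha hx) (mul_nonneg hb hy)

theorem orient_nonneg_of_mem_convexHull (h : ∀ m ∈ S, 0 ≤ orient s P Q m)
    (hm : m ∈ convexHull ℝ S) : 0 ≤ orient s P Q m :=
  convexHull_min (t := {m | 0 ≤ orient s P Q m}) h (convex_orient_nonneg s P Q) hm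

theorem mem_convexHull_triangle (hABC : 0 < orient s A B C) (hA : 0 ≤ orient s B C m)
    (hB : 0 ≤ orient s C A m) (hC : 0 ≤ orient s A B m) : m ∈ convexHull ℝ {A, B, C} := by
  have hsum : orient s A B C = orient s B C m + orient s C A m + orient s A B m := by
    simp only [orient_eq]; ring
  have hm : m = ∑ i, ![orient s B C m / orient s A B C, orient s C A m / orient s A B C,
      orient s A B m / orient s A B C] i • ![A, B, C] i := by
    simp only [Fin.sum_univ_three, Matrix.cons_val]
    have h₀ := hABC.ne'
    ext i
    simp only [PiLp.add_apply, PiLp.smul_apply, smul_eq_mul]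
    field_simp
    fin_cases i <;> simp only [orient_eq, Fin.zero_eta, Fin.mk_one] <;> ring
  rw [hm]
  refine (convex_convexHull ℝ _).sum_mem (fun i _ => ?_) ?_ fun i _ => subset_convexHull ℝ _ ?_
  · fin_cases i
    exacts [div_nonneg hA hABC.le, div_nonneg hB hABC.le, div_nonneg hC hABC.le]
  · simp only [Fin.sum_univ_three, Matrix.cons_val]
    rw [← add_div, ← add_div, ← hsum, div_self hABC.ne']
  · fin_cases i <;> simp

/-- An interior point on the line `A B` could be pushed slightly away from `C` within the hull, to
the negative side of the line. -/
theorem orient_pos_of_mem_interior (hABC : 0 < orient s A B C) (h : ∀ m ∈ S, 0 ≤ orient s A B m)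
    (hm : m ∈ interior (convexHull ℝ S)) : 0 < orient s A B m := by
  refine (orient_nonneg_of_mem_convexHull h (interior_subset hm)).lt_of_ne fun h₀ => ?_
  have hc : Filter.Tendsto (fun t : ℝ => m + t • (m - C)) (nhdsWithin 0 (Set.Ioi 0)) (nhds m) := by
    have : Continuous fun t : ℝ => m + t • (m - C) := by fun_prop
    simpa using (this.tendsto 0).mono_left nhdsWithin_le_nhds
  obtain ⟨t, ht, ht₀⟩ := ((hc.eventually (mem_interior_iff_mem_nhds.1 hm)).and
    self_mem_nhdsWithin).exists
  have h₁ := orient_nonneg_of_mem_convexHull h ht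
  have e : orient s A B (m + t • (m - C)) = (1 + t) * orient s A B m - t * orient s A B C := by
    simp only [orient_eq, PiLp.add_apply, PiLp.smul_apply, PiLp.sub_apply, smul_eq_mul]; ring
  rw [e, ← h₀] at h₁
  nlinarith [mul_pos (Set.mem_Ioi.1 ht₀) hABC]

theorem continuous_orient (s : ℝ) (P Q : Plane) : Continuous (orient s P Q) := by
  have : orient s P Q =
      fun m => s * ((Q 0 - P 0) * (m 1 - P 1) - (Q 1 - P 1) * (m 0 - P 0)) :=
    funext fun m => orient_eq s P Q m
  rw [this]
  fun_prop

theorem mem_interior_triangle_iff (hABC : 0 < orient s A B C) :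
    m ∈ interior (convexHull ℝ {A, B, C}) ↔ StrictlyInside s A B C m := by
  have hBCA : 0 < orient s B C A := by rwa [← orient_rotate]
  have hCAB : 0 < orient s C A B := by rwa [← orient_rotate]
  constructor
  · intro h
    refine ⟨orient_pos_of_mem_interior hABC ?_ h, orient_pos_of_mem_interior hBCA ?_ h,
      orient_pos_of_mem_interior hCAB ?_ h⟩
    all_goals simp [hABC.le, hBCA.le, hCAB.le]
  · intro h
    refine mem_interior.2 ⟨{m | 0 < orient s A B m} ∩ {m | 0 < orient s B C m} ∩
      {m | 0 < orient s C A m}, ?_, ?_, ⟨h.ab, h.bc⟩, h.ca⟩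
    · rintro x ⟨⟨h₁, h₂⟩, h₃⟩
      exact mem_convexHull_triangle hABC (le_of_lt h₂) (le_of_lt h₃) (le_of_lt h₁)
    · have ho : ∀ P Q, IsOpen {m | 0 < orient s P Q m} := fun P Q =>
        isOpen_lt continuous_const (continuous_orient s P Q)
      exact ((ho A B).inter (ho B C)).inter (ho C A)

/-- This is Krein–Milman; the closure is superfluous for finitely many extreme points. -/
theorem convexHull_hullVertices (hS : S.Finite) :
    convexHull ℝ (hullVertices S) = convexHull ℝ S := by
  have h := closure_convexHull_extremePoints (hS.isCompact_convexHull ℝ) (convex_convexHull ℝ S)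
  have hV : (hullVertices S).Finite := hS.subset extremePoints_convexHull_subset
  rwa [← hullVertices, (hV.isClosed_convexHull ℝ).closure_eq] at h

theorem hullVertices_triangle (hABC : 0 < orient s A B C) :
    hullVertices {A, B, C} = {A, B, C} := by
  have key : ∀ {A B C : Plane}, 0 < orient s A B C → A ∈ hullVertices {A, B, C} := by
    intro A B C h
    by_contra hA
    have hsub : hullVertices {A, B, C} ⊆ {B, C} := fun x hx =>
      (extremePoints_convexHull_subset hx).resolve_left fun e => hA (e ▸ hx)
    have hmem : A ∈ convexHull ℝ {B, C} := by
      refine convexHull_mono hsub ?_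
      rw [convexHull_hullVertices (Set.toFinite _)]
      exact subset_convexHull ℝ _ (by simp)
    have := orient_nonneg_of_mem_convexHull (s := s) (P := C) (Q := B) (by simp) hmem
    rw [orient_swap, orient_rotate] at this
    linarith
  refine Set.Subset.antisymm extremePoints_convexHull_subset ?_
  rintro x (rfl | rfl | rfl)
  · exact key hABC
  · have h := key (A := x) (B := C) (C := A) (by rwa [← orient_rotate])
    rwa [Set.pair_comm, Set.insert_comm] at h
  · have h := key (A := x) (B := A) (C := B) (by rwa [orient_rotate])
    rwa [Set.insert_comm, Set.pair_comm] at h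

theorem contains_of_five_le_hullInteriorPoints (hfin : S.Finite) (hS : InGeneralPosition S)
    (hV : (hullVertices S).ncard = 3) (hI : 5 ≤ (hullInteriorPoints S).ncard) :
    ContainsEmptyPseudoTriangle S 7 := by
  obtain ⟨A, B, C, hAB, hAC, hBC, hABC⟩ := Set.ncard_eq_three.1 hV
  have hsub : hullVertices S ⊆ S := extremePoints_convexHull_subset
  have hA : A ∈ S := hsub (by simp [hABC])
  have hB : B ∈ S := hsub (by simp [hABC])
  have hC : C ∈ S := hsub (by simp [hABC])
  have hne : orient 1 A B C ≠ 0 := hS.noThreeAligned A hA B hB C hC hAB hAC hBC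
  -- Taking the orientation itself as `s` covers both cyclic orders of the hull vertices.
  have hpos : 0 < orient (orient 1 A B C) A B C := by
    have e : orient (orient 1 A B C) A B C = orient 1 A B C * orient 1 A B C := by
      simp only [orient]; ring
    rw [e]; exact mul_self_pos.2 hne
  refine contains_of_five_le hS.noThreeAligned hfin hne hA hB hC hpos (hI.trans ?_)
  refine Set.ncard_le_ncard ?_ (hfin.subset fun m hm => hm.1)
  rintro m ⟨hmS, hm⟩
  rw [← convexHull_hullVertices hfin, hABC] at hm
  exact ⟨hmS, (mem_interior_triangle_iff hpos).1 hm⟩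

end Hull

/-! ### The seven-point example. -/

section Crossing

variable {a b c d : Plane}

/-- The segments are the diagonals of a convex quadrilateral, and the parameters of their
intersection are ratios of triangle areas to the whole area. -/
theorem not_disjoint_affineSegment (h₁ : 0 < orient 1 a b c) (h₂ : 0 < orient 1 b a d)
    (h₃ : 0 < orient 1 c d b) (h₄ : 0 < orient 1 d c a) :
    ¬ Disjoint (affineSegment ℝ a b) (affineSegment ℝ c d) := by
  have e : orient 1 d c a + orient 1 c d b = orient 1 a b c + orient 1 b a d := by
    simp only [orient_eq]; ring
  have hD : 0 < orient 1 a b c + orient 1 b a d := add_pos h₁ h₂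
  refine Set.not_disjoint_iff.2
    ⟨AffineMap.lineMap a b (orient 1 d c a / (orient 1 a b c + orient 1 b a d)),
      ⟨_, ⟨by positivity, (div_le_one hD).2 (by linarith)⟩, rfl⟩,
      ⟨orient 1 a b c / (orient 1 a b c + orient 1 b a d),
        ⟨by positivity, (div_le_one hD).2 (by linarith)⟩, ?_⟩⟩
  have hD' := hD.ne'
  ext i
  simp only [AffineMap.lineMap_apply, vsub_eq_sub, vadd_eq_add, PiLp.add_apply, PiLp.smul_apply,
    PiLp.sub_apply, smul_eq_mul]
  field_simp
  fin_cases i <;> simp only [orient_eq, Fin.zero_eta, Fin.mk_one] <;> ring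

end Crossing

/-- The point of the plane with the given natural coordinates. -/
noncomputable def natPoint (a : ℕ × ℕ) : Plane := !₂[(a.1 : ℝ), (a.2 : ℝ)]

/-- Whether `a b c` is a left turn. -/
def ccw (a b c : ℕ × ℕ) : Bool :=
  Nat.blt (a.1 * c.2 + b.1 * a.2 + c.1 * b.2) (a.1 * b.2 + b.1 * c.2 + c.1 * a.2)

/-- Whether the segments `a b` and `c d` cross in their relative interiors. -/
def properlyCross (a b c d : ℕ × ℕ) : Bool :=
  bif ccw a b c then ccw b a d && ccw c d b && ccw d c a
  else ccw b a c && ccw a b d && ccw d c b && ccw c d a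

/-- A triangle with four points inside and without `7`-pseudo-triangles. -/
def sevenPoints : List (ℕ × ℕ) :=
  [(0, 0), (7, 0), (0, 7), (1, 2), (3, 2), (2, 1), (3, 3)]

section Lattice

variable {a b c d : ℕ × ℕ}

theorem natPoint_injective : Function.Injective natPoint := by
  intro a b h
  have h₀ := congrArg (fun m : Plane => m 0) h
  have h₁ := congrArg (fun m : Plane => m 1) h
  simp only [natPoint, PiLp.toLp_apply, Matrix.cons_val] at h₀ h₁
  exact Prod.ext (by exact_mod_cast h₀) (by exact_mod_cast h₁)

theorem cross_natPoint (a b : ℕ × ℕ) :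
    cross (natPoint a) (natPoint b) = a.1 * b.2 - a.2 * b.1 := by
  simp [cross, natPoint]

/-- The negative terms of the determinant stand on the other side of the comparison, so that the
search runs in natural numbers. -/
theorem ccw_iff : ccw a b c = true ↔ 0 < orient 1 (natPoint a) (natPoint b) (natPoint c) := by
  have e : orient 1 (natPoint a) (natPoint b) (natPoint c) =
      ((a.1 * b.2 + b.1 * c.2 + c.1 * a.2 : ℕ) : ℝ) -
        ((a.1 * c.2 + b.1 * a.2 + c.1 * b.2 : ℕ) : ℝ) := by
    simp only [orient_eq, natPoint, Matrix.cons_val]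
    push_cast
    ring
  rw [e, sub_pos, Nat.cast_lt, ccw, Nat.blt_eq]

theorem not_disjoint_of_properlyCross (h : properlyCross a b c d = true) :
    ¬ Disjoint (affineSegment ℝ (natPoint a) (natPoint b))
      (affineSegment ℝ (natPoint c) (natPoint d)) := by
  rw [properlyCross] at h
  cases h₀ : ccw a b c
  · simp only [h₀, cond_false, Bool.and_eq_true, ccw_iff] at h
    obtain ⟨⟨⟨h₁, h₂⟩, h₃⟩, h₄⟩ := h
    rw [affineSegment_comm ℝ (natPoint a)]
    exact not_disjoint_affineSegment h₁ h₂ h₄ h₃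
  · simp only [h₀, cond_true, Bool.and_eq_true, ccw_iff] at h
    obtain ⟨⟨h₂, h₃⟩, h₄⟩ := h
    exact not_disjoint_affineSegment (ccw_iff.1 h₀) h₂ h₃ h₄

theorem noThreeAligned_sevenPoints : NoThreeAligned (natPoint '' {a | a ∈ sevenPoints}) := by
  rintro _ ⟨a, ha, rfl⟩ _ ⟨b, hb, rfl⟩ _ ⟨c, hc, rfl⟩ hab hac hbc h
  have key : ∀ a ∈ sevenPoints, ∀ b ∈ sevenPoints, ∀ c ∈ sevenPoints, a ≠ b → a ≠ c → b ≠ c →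
      ccw a b c = true ∨ ccw a c b = true := by decide +kernel
  rcases key a ha b hb c hc (fun e => hab (e ▸ rfl)) (fun e => hac (e ▸ rfl))
    (fun e => hbc (e ▸ rfl)) with h₁ | h₁
  · exact (ccw_iff.1 h₁).ne' h
  · rw [ccw_iff, orient_swap, h] at h₁
    simp at h₁

theorem corner_pos : 0 < orient 1 (natPoint (0, 0)) (natPoint (7, 0)) (natPoint (0, 7)) :=
  ccw_iff.1 rfl

theorem convexHull_sevenPoints : convexHull ℝ (natPoint '' {a | a ∈ sevenPoints}) =
    convexHull ℝ {natPoint (0, 0), natPoint (7, 0), natPoint (0, 7)} := by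
  refine Set.Subset.antisymm (convexHull_min ?_ (convex_convexHull ℝ _)) (convexHull_mono ?_)
  · rintro _ ⟨a, ha, rfl⟩
    have key : ∀ a ∈ sevenPoints, ccw (0, 0) a (7, 0) = false ∧ ccw (7, 0) a (0, 7) = false ∧
        ccw (0, 7) a (0, 0) = false := by decide +kernel
    have nonneg : ∀ {a b c}, ccw a c b = false →
        0 ≤ orient 1 (natPoint a) (natPoint b) (natPoint c) := by
      intro a b c h
      rw [← Bool.not_eq_true, ccw_iff, orient_swap] at h
      linarith
    obtain ⟨h₁, h₂, h₃⟩ := key a ha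
    exact mem_convexHull_triangle corner_pos (nonneg h₂) (nonneg h₃) (nonneg h₁)
  · rintro _ (rfl | rfl | rfl) <;> exact ⟨_, by decide, rfl⟩

theorem hullVertices_sevenPoints_ncard :
    (hullVertices (natPoint '' {a | a ∈ sevenPoints})).ncard = 3 := by
  rw [hullVertices, convexHull_sevenPoints, ← hullVertices, hullVertices_triangle corner_pos]
  refine Set.ncard_eq_three.2 ⟨_, _, _, ?_, ?_, ?_, rfl⟩ <;>
    exact natPoint_injective.ne (by decide)

theorem hullInteriorPoints_sevenPoints_ncard :
    (hullInteriorPoints (natPoint '' {a | a ∈ sevenPoints})).ncard = 4 := by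
  have e : hullInteriorPoints (natPoint '' {a | a ∈ sevenPoints}) =
      natPoint '' (sevenPoints.toFinset.filter fun a =>
        ccw (0, 0) (7, 0) a = true ∧ ccw (7, 0) (0, 7) a = true ∧ ccw (0, 7) (0, 0) a = true :
          Finset (ℕ × ℕ)) := by
    ext m
    simp only [hullInteriorPoints, convexHull_sevenPoints, Set.mem_inter_iff,
      mem_interior_triangle_iff corner_pos]
    constructor
    · rintro ⟨⟨a, ha, rfl⟩, h⟩
      exact ⟨a, by simpa [ccw_iff] using ⟨ha, h.ab, h.bc, h.ca⟩, rfl⟩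
    · rintro ⟨a, ha, rfl⟩
      simp only [Finset.coe_filter, List.mem_toFinset, ccw_iff] at ha
      exact ⟨⟨a, ha.1, rfl⟩, ha.2.1, ha.2.2.1, ha.2.2.2⟩
  rw [e, Set.ncard_image_of_injective _ natPoint_injective, Set.ncard_coe_finset]
  decide +kernel

/-- A backtracking search: a branch is closed as soon as a vertex repeats or a new edge properly
crosses an earlier one. The last two clauses reject complete orders that are not anti-clockwise or
do not have exactly three left turns. -/
theorem sevenPoints_search : (sevenPoints.all fun a => sevenPoints.all fun b => b == a ||
    sevenPoints.all fun c => c == a || c == b ||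
    sevenPoints.all fun d => d == a || d == b || d == c || properlyCross a b c d ||
    sevenPoints.all fun e => e == a || e == b || e == c || e == d ||
      properlyCross a b d e || properlyCross b c d e ||
    sevenPoints.all fun f => f == a || f == b || f == c || f == d || f == e ||
      properlyCross a b e f || properlyCross b c e f || properlyCross c d e f ||
    sevenPoints.all fun g => g == a || g == b || g == c || g == d || g == e || g == f ||
      properlyCross a b f g || properlyCross b c f g || properlyCross c d f g ||
      properlyCross d e f g || properlyCross b c g a || properlyCross c d g a ||
      properlyCross d e g a || properlyCross e f g a ||
      !(Nat.blt (a.2 * b.1 + b.2 * c.1 + c.2 * d.1 + d.2 * e.1 + e.2 * f.1 + f.2 * g.1 + g.2 * a.1)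
        (a.1 * b.2 + b.1 * c.2 + c.1 * d.2 + d.1 * e.2 + e.1 * f.2 + f.1 * g.2 + g.1 * a.2)) ||
      !(Nat.beq ((ccw g a b).toNat + (ccw a b c).toNat + (ccw b c d).toNat + (ccw c d e).toNat +
        (ccw d e f).toNat + (ccw e f g).toNat + (ccw f g a).toNat) 3)) = true := by
  decide +kernel

theorem not_containsPseudoTriangle_sevenPoints :
    ¬ ContainsPseudoTriangle (natPoint '' {a | a ∈ sevenPoints}) 7 := by
  rintro ⟨P, hP, hPS⟩
  choose p hp hpP using fun i => hPS ⟨i, rfl⟩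
  have hinj : Function.Injective p := fun i j hij =>
    hP.simple.injective (by rw [← hpP i, ← hpP j, hij])
  have hne : ∀ i j, i ≠ j → (p i == p j) = false := fun i j hij => by
    simpa using hinj.ne hij
  -- The index conditions form a single conjunction so that `decide` can discharge them for concrete
  -- edges.
  have hcross : ∀ i k j l : Fin 7, (finRotate 7 i = k ∧ finRotate 7 j = l ∧ i ≠ j ∧ j ≠ k ∧ i ≠ l) →
      properlyCross (p i) (p k) (p j) (p l) = false := by
    rintro i _ j _ ⟨rfl, rfl, hij, hjk, hil⟩
    by_contra h
    refine not_disjoint_of_properlyCross (Bool.eq_true_of_not_eq_false h) ?_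
    simp only [hpP]
    exact hP.simple.disjoint i j hij hjk hil
  have harea : Nat.blt ((p 0).2 * (p 1).1 + (p 1).2 * (p 2).1 + (p 2).2 * (p 3).1 +
      (p 3).2 * (p 4).1 + (p 4).2 * (p 5).1 + (p 5).2 * (p 6).1 + (p 6).2 * (p 0).1)
      ((p 0).1 * (p 1).2 + (p 1).1 * (p 2).2 + (p 2).1 * (p 3).2 + (p 3).1 * (p 4).2 +
      (p 4).1 * (p 5).2 + (p 5).1 * (p 6).2 + (p 6).1 * (p 0).2) = true := by
    have h : 0 < ∑ i, cross (natPoint (p i)) (natPoint (p (finRotate 7 i))) := by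
      have h := hP.anticlockwise
      simp only [Polygon.IsAnticlockwise, Polygon.signedArea, Polygon.next, ← hpP] at h
      linarith
    simp only [cross_natPoint, Fin.sum_univ_seven] at h
    rw [Nat.blt_eq, ← Nat.cast_lt (α := ℝ)]
    push_cast
    change 0 < ((p 0).1 * (p 1).2 - (p 0).2 * (p 1).1 : ℝ) +
      ((p 1).1 * (p 2).2 - (p 1).2 * (p 2).1) + ((p 2).1 * (p 3).2 - (p 2).2 * (p 3).1) +
      ((p 3).1 * (p 4).2 - (p 3).2 * (p 4).1) + ((p 4).1 * (p 5).2 - (p 4).2 * (p 5).1) +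
      ((p 5).1 * (p 6).2 - (p 5).2 * (p 6).1) + ((p 6).1 * (p 0).2 - (p 6).2 * (p 0).1) at h
    linarith
  have hcount : Nat.beq ((ccw (p 6) (p 0) (p 1)).toNat + (ccw (p 0) (p 1) (p 2)).toNat +
      (ccw (p 1) (p 2) (p 3)).toNat + (ccw (p 2) (p 3) (p 4)).toNat +
      (ccw (p 3) (p 4) (p 5)).toNat + (ccw (p 4) (p 5) (p 6)).toNat +
      (ccw (p 5) (p 6) (p 0)).toNat) 3 = true := by
    have hset : {i : Fin 7 | P.interiorAngle i < Real.pi} =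
        (Finset.univ.filter fun i => ccw (p ((finRotate 7).symm i)) (p i) (p (finRotate 7 i)) = true :
          Finset (Fin 7)) := by
      ext i
      have h := noThreeAligned_sevenPoints _ ⟨_, hp ((finRotate 7).symm i), rfl⟩ _ ⟨_, hp i, rfl⟩ _
        ⟨_, hp (finRotate 7 i), rfl⟩ (natPoint_injective.ne (hinj.ne (by decide +revert)))
        (natPoint_injective.ne (hinj.ne (by decide +revert)))
        (natPoint_injective.ne (hinj.ne (by decide +revert)))
      simp only [Finset.coe_filter, Finset.mem_univ, true_and, Set.mem_ofPred_eq, ccw_iff]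
      rw [hpP, hpP, hpP] at h ⊢
      exact Polygon.interiorAngle_lt_pi_iff h
    have h := hP.convex_vertices
    rw [hset, Set.ncard_coe_finset, Finset.card_filter, Fin.sum_univ_seven] at h
    rw [Nat.beq_eq, ← h]
    simp only [Bool.toNat, cond_eq_ite]
    rfl
  -- Following the vertices of the hypothetical polygon through the search, every alternative
  -- evaluates to `false`.
  have h := List.all_eq_true.1 (List.all_eq_true.1 sevenPoints_search _ (hp 0)) _ (hp 1)
  simp only [hne 1 0 (by decide), Bool.false_or] at h
  have h := List.all_eq_true.1 h _ (hp 2)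
  simp only [hne 2 0 (by decide), hne 2 1 (by decide), Bool.false_or] at h
  have h := List.all_eq_true.1 h _ (hp 3)
  simp only [hne 3 0 (by decide), hne 3 1 (by decide), hne 3 2 (by decide),
    hcross 0 1 2 3 (by decide), Bool.false_or] at h
  have h := List.all_eq_true.1 h _ (hp 4)
  simp only [hne 4 0 (by decide), hne 4 1 (by decide), hne 4 2 (by decide), hne 4 3 (by decide),
    hcross 0 1 3 4 (by decide), hcross 1 2 3 4 (by decide), Bool.false_or] at h
  have h := List.all_eq_true.1 h _ (hp 5)
  simp only [hne 5 0 (by decide), hne 5 1 (by decide), hne 5 2 (by decide), hne 5 3 (by decide),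
    hne 5 4 (by decide), hcross 0 1 4 5 (by decide), hcross 1 2 4 5 (by decide),
    hcross 2 3 4 5 (by decide), Bool.false_or] at h
  have h := List.all_eq_true.1 h _ (hp 6)
  simp only [hne 6 0 (by decide), hne 6 1 (by decide), hne 6 2 (by decide), hne 6 3 (by decide),
    hne 6 4 (by decide), hne 6 5 (by decide), hcross 0 1 5 6 (by decide),
    hcross 1 2 5 6 (by decide), hcross 2 3 5 6 (by decide), hcross 3 4 5 6 (by decide),
    hcross 1 2 6 0 (by decide), hcross 2 3 6 0 (by decide), hcross 3 4 6 0 (by decide),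
    hcross 4 5 6 0 (by decide), harea, hcount, Bool.false_or, Bool.not_true] at h
  exact absurd h (by decide)

end Lattice

theorem theorem2 :
    (∀ S : Set Plane, S.Finite → InGeneralPosition S → (hullVertices S).ncard = 3 →
      5 ≤ (hullInteriorPoints S).ncard → ContainsEmptyPseudoTriangle S 7) ∧
    (∃ S : Set Plane, S.Finite ∧ InGeneralPosition S ∧ (hullVertices S).ncard = 3 ∧
      (hullInteriorPoints S).ncard = 4 ∧ ¬ ContainsPseudoTriangle S 7) :=
  ⟨fun _ => contains_of_five_le_hullInteriorPoints,
    natPoint '' {a | a ∈ sevenPoints}, (List.finite_toSet _).image _,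
    noThreeAligned_sevenPoints.inGeneralPosition, hullVertices_sevenPoints_ncard,
    hullInteriorPoints_sevenPoints_ncard, not_containsPseudoTriangle_sevenPoints⟩
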